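/- Let $N\ge 3$ be odd and $L,m_{\rm i},m_{\rm h}>0$ (units $\hbar=1$). Consider $N$ spinless fermions of mass $m_{\rm h}$ (coordinates $x_1,\dots,x_N$) and one impurity of mass $m_{\rm i}$ (coordinate $x_{\rm i}$) in one dimension with periodic boundary conditions of period $L$; the Hilbert space is the space of $L^2$ functions on the torus $(\mathbb R/L\mathbb Z)^{N+1}$ that are antisymmetric in $x_1,\dots,x_N$. Let $$\hat H=\hat H^0_{\rm h}+\frac{\hat p_{\rm i}^2}{2m_{\rm i}}+\sum_{n=1}^N U(x_n-x_{\rm i}),\qquad \hat H^0_{\rm h}=\sum_{n=1}^N\frac{\hat p_n^2}{2m_{\rm h}}-C,\qquad C=\frac{k_{\rm F}^2}{6m_{\rm h}}\,\frac{N(N+1)}{N-1},\qquad k_{\rm F}=\frac{2\pi}{L}\,\frac{N-1}{2},$$ where the interaction is everywhere repulsive and of finite total strength: $U\ge 0$ and $\overline U=\int U(x)\,dx<\infty$. More generally, $U(x)\,dx$ may be any finite positive Borel measure on $\mathbb R$, for example $g\,\delta(x)\,dx$ with $g\ge0$; it acts on the ring through its $L$-periodization (an $L$-periodic $U$ is represented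 by its restriction to one period, so that $\overline U$ is the integral over one period). $\hat H$ is understood as the self-adjoint operator associated with the closure of its quadratic form on antisymmetric trigonometric polynomials. Let $p_0\in\frac{2\pi}{L}\mathbb Z$ be arbitrary, and let $|{\rm FS},p_0\rangle$ be the product of the normalized Slater determinant of the plane waves with momenta $-k_{\rm F},-k_{\rm F}+\frac{2\pi}{L},\dots,k_{\rm F}$ (the Fermi sea) and of the normalized impurity plane wave of momentum $p_0$. Assume that the eigenvalues of $\hat H$ in the subspace of total momentum $p_0$ are nondegenerate. Then the unitary group $e^{-i\hat Ht}$ generated by $\hat H$ exists and is unique, the expectation value $\langle {\rm FS},p_0|e^{i\hat Ht}\hat p_{\rm i}e^{-i\hat Ht}|{\rm FS},p_0\rangle$ is well defined for all $t$ and locally integrable in $t$, the infinite-time momentum $$p_\infty=\lim_{t\to\infty}\frac1t\int_0^t \langle {\rm FS},p_0|e^{i\hat Ht'}\,\hat p_{\rm i}\,e^{-i\hat Ht'}|{\rm FS},p_0\rangle\,dt'$$ exists, and $$|p_\infty|\le\sqrt{p_0^2+\frac{2}{\pi}\,m_{\rm i}\,k_{\rm F}\,\overline U\,\frac{N}{N-1}}\,.$$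 -/

import Mathlib

open MeasureTheory Filter Topology

noncomputable section

namespace MobileImpurity

/-- The data of the model: `N` host fermions and one impurity on a ring of length `L`, masses
`mi` (impurity) and `mh` (host), in units with `ħ = 1`.  The repulsive interaction is a positive
Borel measure `U` on the line: `U(x) dx` for a nonnegative function, `g • δ₀` for the pointlike
interaction.  On the ring, it acts through its `L`-periodization; so an interaction given as an
`L`-periodic function is represented by its restriction to one period. -/
structure System where
  N : ℕ
  L : ℝ
  mi : ℝ
  mh : ℝ
  U : Measure ℝ

/-- The particle labels: `some n` is the `n`-th fermion, `none` is the impurity. -/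
abbrev Label (N : ℕ) : Type := Option (Fin N)

/-- Positions of all particles on the ring, measured in units of `L`. -/
abbrev Config (N : ℕ) : Type := UnitAddTorus (Label N)

/-- Momenta of all particles, measured in units of `2π/L`. -/
abbrev Mode (N : ℕ) : Type := Label N → ℤ

/-- The normalized product Haar measure on configurations. -/
abbrev configMeasure (N : ℕ) : Measure (Config N) :=
  Measure.pi fun _ => (AddCircle.haarAddCircle : Measure UnitAddCircle)

/-- Square integrable wave functions of `N + 1` distinguishable particles. -/
abbrev WaveSpace (N : ℕ) : Type := Lp ℂ 2 (configMeasure N)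

/-- The plane wave `x ↦ exp (2πi ∑ⱼ kⱼ xⱼ)` as an `L²` function. -/
def planeWave {N : ℕ} (k : Mode N) : WaveSpace N :=
  ContinuousMap.toLp (E := ℂ) 2 (configMeasure N) ℂ (UnitAddTorus.mFourier k)

/-- The amplitude of the plane wave `k` in `ψ`. -/
def amplitude {N : ℕ} (ψ : WaveSpace N) (k : Mode N) : ℂ := inner ℂ (planeWave k) ψ

/-- Relabelling of the fermions. -/
def relabel {N : ℕ} {α : Type*} (σ : Equiv.Perm (Fin N)) (x : Label N → α) : Label N → α :=
  x ∘ Equiv.optionCongr σ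

theorem measurePreserving_relabel {N : ℕ} (σ : Equiv.Perm (Fin N)) :
    MeasurePreserving (relabel σ : Config N → Config N) (configMeasure N) (configMeasure N) := by
  have h := measurePreserving_piCongrLeft
    (fun _ : Label N => (AddCircle.haarAddCircle : Measure UnitAddCircle))
    (Equiv.optionCongr σ).symm
  convert h using 1
  funext x i
  have h2 := Equiv.piCongrLeft_apply_apply (fun _ : Label N => UnitAddCircle)
    (Equiv.optionCongr σ).symm x (Equiv.optionCongr σ i)
  rw [Equiv.symm_apply_apply] at h2
  rw [MeasurableEquiv.coe_piCongrLeft, h2]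
  rfl

/-- The action of a permutation of the fermions on wave functions. -/
def permute {N : ℕ} (σ : Equiv.Perm (Fin N)) : WaveSpace N →ₗᵢ[ℂ] WaveSpace N :=
  Lp.compMeasurePreservingₗᵢ ℂ (relabel σ) (measurePreserving_relabel σ)

/-- The sign of a permutation as a complex number. -/
def csign {N : ℕ} (σ : Equiv.Perm (Fin N)) : ℂ := ((Equiv.Perm.sign σ : ℤ) : ℂ)

/-- The Hilbert space of the system: wave functions antisymmetric in the fermions. -/
def fermionSpace (N : ℕ) : Submodule ℂ (WaveSpace N) where
  carrier := {ψ | ∀ σ : Equiv.Perm (Fin N), permute σ ψ = csign σ • ψ}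
  add_mem' := by
    intro ψ φ hψ hφ σ
    rw [map_add, hψ σ, hφ σ, smul_add]
  zero_mem' := by
    intro σ
    rw [map_zero, smul_zero]
  smul_mem' := by
    intro a ψ hψ σ
    rw [map_smul, hψ σ, smul_comm]

/-- A finite combination of plane waves, by its coefficients. -/
abbrev TrigPoly (N : ℕ) : Type := Mode N →₀ ℂ

/-- The values of a finite combination of plane waves. -/
def TrigPoly.eval {N : ℕ} (c : TrigPoly N) (x : Config N) : ℂ :=
  c.sum fun k a => a * UnitAddTorus.mFourier k x

/-- A finite combination of plane waves as an `L²` function. -/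
def TrigPoly.toWave {N : ℕ} (c : TrigPoly N) : WaveSpace N :=
  c.sum fun k a => a • planeWave k

/-- Antisymmetry in the fermions. -/
def TrigPoly.IsAntisymm {N : ℕ} (c : TrigPoly N) : Prop :=
  ∀ (σ : Equiv.Perm (Fin N)) (k : Mode N), c (relabel σ k) = csign σ * c k

theorem permute_planeWave {N : ℕ} (σ : Equiv.Perm (Fin N)) (k : Mode N) :
    permute σ (planeWave (relabel σ k)) = planeWave k := by
  apply Lp.ext
  have h1 := Lp.coeFn_compMeasurePreserving (planeWave (relabel σ k)) (measurePreserving_relabel σ)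
  have h2 := (measurePreserving_relabel σ).quasiMeasurePreserving.ae_eq_comp
    (ContinuousMap.coeFn_toLp (𝕜 := ℂ) (p := 2) (configMeasure N)
      (UnitAddTorus.mFourier (relabel σ k)))
  have h3 := ContinuousMap.coeFn_toLp (𝕜 := ℂ) (p := 2) (configMeasure N)
      (UnitAddTorus.mFourier k)
  refine (h1.trans h2).trans (EventuallyEq.trans ?_ h3.symm)
  refine Eventually.of_forall fun x => ?_
  simp only [Function.comp_apply, UnitAddTorus.mFourier, ContinuousMap.coe_mk, relabel]
  exact Equiv.prod_comp (Equiv.optionCongr σ) fun i => fourier (k i) (x i)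

theorem TrigPoly.IsAntisymm.toWave_mem {N : ℕ} {c : TrigPoly N} (hc : c.IsAntisymm) :
    c.toWave ∈ fermionSpace N := by
  intro σ
  let e : Mode N ≃ Mode N := Equiv.arrowCongr (Equiv.optionCongr σ).symm (Equiv.refl ℤ)
  have he : ∀ k, e k = relabel σ k := fun k => rfl
  have hs : csign σ * csign σ = 1 := by
    rcases Int.units_eq_one_or (Equiv.Perm.sign σ) with h | h <;> simp [csign, h]
  have h1 : c.toWave = c.support.sum fun k => c k • planeWave k := rfl
  have h2 : c.support.sum (fun k => c k • planeWave k)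
      = c.support.sum fun k => c (relabel σ k) • planeWave (relabel σ k) := by
    symm
    refine Finset.sum_equiv e ?_ ?_
    · intro k
      rw [Finsupp.mem_support_iff, Finsupp.mem_support_iff, he, hc σ k]
      have : csign σ ≠ 0 := left_ne_zero_of_mul_eq_one hs
      simp [this]
    · intro k _
      rw [he]
  conv_lhs => rw [h1, h2]
  rw [h1, map_sum, Finset.smul_sum]
  refine Finset.sum_congr rfl fun k _ => ?_
  rw [map_smul, permute_planeWave, hc σ k, mul_smul]

namespace System

variable (S : System)

/-- The momentum quantum `2π/L`. -/
def δk : ℝ := 2 * Real.pi / S.L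

/-- The Fermi momentum. -/
def kF : ℝ := (2 * Real.pi / S.L) * (((S.N : ℝ) - 1) / 2)

/-- The constant that puts the energy of the Fermi sea to zero. -/
def C : ℝ := S.kF ^ 2 / (6 * S.mh) * ((S.N : ℝ) * ((S.N : ℝ) + 1) / ((S.N : ℝ) - 1))

/-- The integral of the potential. -/
def Ubar : ℝ := S.U.real Set.univ

/-- The eigenvalue of `H⁰ = H⁰_h + H⁰_i` on a plane wave. -/
def freeEnergy (k : Mode S.N) : ℝ :=
  (∑ n : Fin S.N, (S.δk * k (some n)) ^ 2 / (2 * S.mh) - S.C)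
    + (S.δk * k none) ^ 2 / (2 * S.mi)

/-- The matrix element `⟨c| V |d⟩` of `V = ∑ₙ U(xₙ - xᵢ)`, in the variable `y = xₙ - xᵢ`: the
position of the `n`-th fermion is replaced by `xᵢ + y` and `y` is integrated against `U(y) dy`.
The factor `1/L` is there because the configuration measure is normalized. -/
def potentialForm (c d : TrigPoly S.N) : ℂ :=
  ∑ n : Fin S.N, ((S.L : ℂ)⁻¹ * ∫ x : Config S.N, ∫ y : ℝ,
    (starRingEnd ℂ (c.eval (Function.update x (some n) (x none + ((y / S.L : ℝ) : UnitAddCircle))))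
      * d.eval (Function.update x (some n) (x none + ((y / S.L : ℝ) : UnitAddCircle))))
    ∂S.U ∂(configMeasure S.N))

/-- The matrix element `⟨c| H |d⟩`, where `H = H⁰_h + H⁰_i + V`. -/
def energyForm (c d : TrigPoly S.N) : ℂ :=
  (d.sum fun k a => starRingEnd ℂ (c k) * (S.freeEnergy k : ℂ) * a) + S.potentialForm c d

/-- The graph of the Hamiltonian: `ψ` is in the domain of `H` and `H ψ = η`.  Here `H` is the
self-adjoint operator of the closure of the quadratic form `energyForm` on antisymmetric
finite combinations of plane waves (the Friedrichs construction): `ψ` is the `L²` limit of a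
sequence that is Cauchy for the form, and the form at `ψ` is represented by `η`. -/
def IsHamiltonian (ψ η : fermionSpace S.N) : Prop :=
  ∃ c : ℕ → TrigPoly S.N, (∀ j, (c j).IsAntisymm) ∧
    Tendsto (fun j => (c j).toWave) atTop (𝓝 (ψ : WaveSpace S.N)) ∧
    Tendsto (fun j : ℕ × ℕ => S.energyForm (c j.1 - c j.2) (c j.1 - c j.2)) atTop (𝓝 0) ∧
    ∀ d : TrigPoly S.N, d.IsAntisymm →
      Tendsto (fun j => S.energyForm d (c j)) atTop
        (𝓝 (inner ℂ d.toWave (η : WaveSpace S.N)))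

/-- `W t = exp (-i H t)`: a strongly continuous one-parameter unitary group whose generator,
with its exact domain, is `-i H`. -/
structure IsPropagator (W : ℝ → (fermionSpace S.N ≃ₗᵢ[ℂ] fermionSpace S.N)) : Prop where
  zero : ∀ ψ, W 0 ψ = ψ
  add : ∀ s t ψ, W (s + t) ψ = W s (W t ψ)
  continuous : ∀ ψ, Continuous fun t => W t ψ
  generator : ∀ ψ η, S.IsHamiltonian ψ η ↔
    HasDerivAt (fun t => W t ψ) (-(Complex.I • η)) 0

/-- `ψ` is in the domain of the impurity momentum operator `p_i`, which multiplies the amplitude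
of each plane wave by the impurity momentum. -/
def InMomentumDomain (ψ : fermionSpace S.N) : Prop :=
  Summable fun k : Mode S.N => ‖((S.δk * k none : ℝ) : ℂ) * amplitude (ψ : WaveSpace S.N) k‖ ^ 2

/-- The expectation value `⟨ψ| p_i |ψ⟩` of the impurity momentum. -/
def momentum (ψ : fermionSpace S.N) : ℝ :=
  ∑' k : Mode S.N, S.δk * k none * ‖amplitude (ψ : WaveSpace S.N) k‖ ^ 2

/-- `ψ` has total momentum `p`. -/
def HasTotalMomentum (p : ℝ) (ψ : fermionSpace S.N) : Prop :=
  ∀ k : Mode S.N, amplitude (ψ : WaveSpace S.N) k ≠ 0 → ∑ j, S.δk * k j = p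

/-- The eigenvalues of `H` in the subspace of total momentum `p` are nondegenerate. -/
def NondegenerateAt (p : ℝ) : Prop :=
  ∀ (E : ℝ) (ψ φ : fermionSpace S.N), S.HasTotalMomentum p ψ → S.HasTotalMomentum p φ →
    S.IsHamiltonian ψ ((E : ℂ) • ψ) → S.IsHamiltonian φ ((E : ℂ) • φ) → ψ ≠ 0 →
    ∃ a : ℂ, φ = a • ψ

/-- The momenta `-(N-1)/2, …, (N-1)/2` of the Fermi sea, for odd `N`, together with the impurity
momentum `n₀`, in units of `2π/L`. -/
def seaMode (n₀ : ℤ) : Mode S.N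
  | none => n₀
  | some n => (n : ℤ) - ((S.N : ℤ) - 1) / 2

/-- The coefficients of `|FS, p₀⟩`: the normalized Slater determinant of the Fermi sea times the
plane wave of the impurity with momentum `p₀ = 2π n₀ / L`. -/
def seaCoeff (n₀ : ℤ) : TrigPoly S.N :=
  ∑ σ : Equiv.Perm (Fin S.N),
    Finsupp.single (relabel σ (S.seaMode n₀)) (csign σ * ((Real.sqrt (S.N.factorial) : ℝ) : ℂ)⁻¹)

theorem seaCoeff_isAntisymm (n₀ : ℤ) : (S.seaCoeff n₀).IsAntisymm := by
  classical
  intro τ k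
  have hmul : ∀ σ, relabel (σ * τ) (S.seaMode n₀) = relabel τ (relabel σ (S.seaMode n₀)) := by
    intro σ
    funext i
    cases i <;> rfl
  have hinj : Function.Injective (relabel τ : Mode S.N → Mode S.N) := by
    intro a b h
    exact (Equiv.optionCongr τ).surjective.injective_comp_right h
  have hcs : ∀ σ, csign (σ * τ) = csign τ * csign σ := by
    intro σ
    simp [csign, mul_comm]
  simp only [seaCoeff, Finsupp.finsetSum_apply, Finset.mul_sum]
  rw [← Equiv.sum_comp (Equiv.mulRight τ)]
  refine Finset.sum_congr rfl fun σ _ => ?_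
  rw [Equiv.coe_mulRight, hmul, hcs, Finsupp.single_apply, Finsupp.single_apply]
  simp only [hinj.eq_iff, mul_ite, mul_zero, mul_assoc]

/-- The initial state `|FS, p₀⟩`, where `p₀ = 2π n₀ / L`. -/
def initialState (n₀ : ℤ) : fermionSpace S.N :=
  ⟨(S.seaCoeff n₀).toWave, (S.seaCoeff_isAntisymm n₀).toWave_mem⟩

end System

end MobileImpurity

end

/-! The bound is conservation of energy combined with positivity. On antisymmetric states the host
kinetic energy is at least that of the Fermi sea, which is `C`, and the interaction is nonnegative;
hence `p_i² / (2 m_i) ≤ H` as quadratic forms (`re_energyForm_ge`). In `|FS, p₀⟩` a fermion at a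
given distance from the impurity has uniform density, so the initial energy is exactly `p₀² / (2
m_i) + N Ū / L` (`re_energyForm_seaCoeff`). By Cauchy–Schwarz, `|⟨p_i⟩|² ≤ ⟨p_i²⟩ ≤ p₀² + 2 m_i N Ū
/ L` at every time, and the average inherits the bound.

For the operator theory, let `Q` be the completion of the antisymmetric polynomials in the norm of
the form shifted by `1 + C`, and `G` the map from `Q` to the Hilbert space. The Friedrichs operator
satisfies `H + 1 + C = (G G†)⁻¹` (`isHamiltonian_iff`). The kinetic energy makes `G` compact
(`IsFormEmbedding.isCompactOperator`), so `H` has an eigenbasis, which yields the unitary group and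
its uniqueness.

The impurity momentum is unbounded on the Hilbert space but bounded on `Q`. The evolution is
therefore lifted to `Q` through an eigenbasis of `G† G`. There the expectation value is a matrix
element of a bounded operator under an evolution with pure point spectrum, and such functions have
time averages (`hasTimeMean_inner_evolution`). -/

noncomputable section

namespace MobileImpurity

/-! ### Unitary groups with pure point spectrum and their time averages. -/

section Evolution

universe u

variable {E : Type u} [NormedAddCommGroup E] [InnerProductSpace ℂ E]

section Basis

variable {ι : Type*} (b : HilbertBasis ι ℂ E)

theorem hilbertBasis_ext {x y : E} (h : ∀ i, inner ℂ (b i) x = inner ℂ (b i) y) : x = y := by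
  apply b.repr.injective
  ext i
  rw [b.repr_apply_apply, b.repr_apply_apply, h i]

/-- The limit step is phrased by approximation rather than closedness, so that it can be met by
estimates uniform in time. -/
theorem hilbertBasis_induction {P : E → Prop} (hb : ∀ i, P (b i)) (h0 : P 0)
    (hadd : ∀ x y, P x → P y → P (x + y)) (hsmul : ∀ (a : ℂ) x, P x → P (a • x))
    (hlim : ∀ x, (∀ ε > 0, ∃ y, P y ∧ ‖x - y‖ < ε) → P x) (x : E) : P x := by
  have hspan : ∀ y ∈ Submodule.span ℂ (Set.range b), P y := fun y hy => by
    induction hy using Submodule.span_induction with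
    | mem y hy => obtain ⟨i, rfl⟩ := hy; exact hb i
    | zero => exact h0
    | add y z _ _ hy hz => exact hadd y z hy hz
    | smul a y _ hy => exact hsmul a y hy
  have hx : x ∈ closure (Submodule.span ℂ (Set.range b) : Set E) := by
    rw [← Submodule.topologicalClosure_coe, b.dense_span]
    trivial
  refine hlim x fun ε hε => ?_
  obtain ⟨y, hy, hxy⟩ := Metric.mem_closure_iff.1 hx ε hε
  exact ⟨y, hspan y hy, by rwa [← dist_eq_norm]⟩

end Basis

/-- An eigenbasis of a compact symmetric operator. -/
theorem exists_hilbertBasis_eigenvectors [CompleteSpace E] (T : E →L[ℂ] E)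
    (hc : IsCompactOperator T) (hs : (T : E →ₗ[ℂ] E).IsSymmetric) :
    ∃ (ι : Type u) (b : HilbertBasis ι ℂ E) (τ : ι → ℝ), ∀ i, T (b i) = (τ i : ℂ) • b i := by
  have hcl : ∀ μ : ℂ, IsClosed (Module.End.eigenspace (T : E →ₗ[ℂ] E) μ : Set E) := fun μ => by
    have : (Module.End.eigenspace (T : E →ₗ[ℂ] E) μ : Set E) = {x | T x = μ • x} := by
      ext x
      simp
    rw [this]
    exact isClosed_eq T.continuous (by fun_prop)
  have : ∀ μ : ℂ, CompleteSpace (Module.End.eigenspace (T : E →ₗ[ℂ] E) μ) := fun μ =>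
    (hcl μ).completeSpace_coe
  choose w v hv using fun μ : ℂ =>
    exists_hilbertBasis ℂ (Module.End.eigenspace (T : E →ₗ[ℂ] E) μ)
  let f : (Σ μ : ℂ, w μ) → E := fun a => (v a.1 a.2 : E)
  have hf : Orthonormal ℂ f :=
    hs.orthogonalFamily_eigenspaces.orthonormal_sigma_orthonormal fun μ => (v μ).orthonormal
  have hT : ∀ a, T (f a) = a.1 • f a := fun a =>
    Module.End.mem_eigenspace_iff.1 (v a.1 a.2).2
  -- The family `f` collects bases of all eigenspaces. A vector orthogonal to it is orthogonal to
  -- every eigenspace, and by the spectral theorem for compact symmetric operators only `0` is.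
  have hbot : (Submodule.span ℂ (Set.range f))ᗮ = ⊥ := by
    rw [eq_bot_iff,
      ← ContinuousLinearMap.orthogonalComplement_iSup_eigenspaces_eq_bot hc hs]
    rw [← Submodule.iInf_orthogonal]
    intro x hx
    rw [Submodule.mem_iInf]
    intro μ
    rw [Submodule.mem_orthogonal'] at hx ⊢
    intro y hy
    refine hilbertBasis_induction (v μ) (P := fun y => inner ℂ x (y : E) = 0)
      (fun i => hx _ (Submodule.subset_span ⟨⟨μ, i⟩, rfl⟩)) (by simp)
      (fun y z hy hz => by simp [hy, hz])
      (fun a y hy => by simp [hy]) (fun y hy => ?_) ⟨y, hy⟩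
    by_contra hne
    have hx0 : 0 < ‖x‖ := norm_pos_iff.2 fun h => hne (by simp [h])
    obtain ⟨z, hz, hyz⟩ := hy (‖inner ℂ x (y : E)‖ / ‖x‖) (div_pos (norm_pos_iff.2 hne) hx0)
    have h1 : inner ℂ x (y : E) = inner ℂ x ((y - z : Module.End.eigenspace _ μ) : E) := by
      simp [hz]
    have h2 := norm_inner_le_norm (𝕜 := ℂ) x ((y - z : Module.End.eigenspace _ μ) : E)
    rw [← h1] at h2
    rw [lt_div_iff₀ hx0, mul_comm] at hyz
    exact absurd h2 (not_le.2 hyz)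
  refine ⟨_, HilbertBasis.mkOfOrthogonalEqBot hf hbot, fun a => a.1.re, fun a => ?_⟩
  rw [HilbertBasis.coe_mkOfOrthogonalEqBot, hT]
  have hne : f a ≠ 0 := hf.ne_zero a
  have := hs.conj_eigenvalue_eq_self
    (Module.End.hasEigenvalue_of_hasEigenvector ⟨(v a.1 a.2).2, hne⟩)
  rw [Complex.conj_eq_iff_re.1 this]

/-- The phase factor `exp (-i e t)`. -/
def phase (e t : ℝ) : ℂ := Complex.exp (-(Complex.I * e * t))

theorem norm_phase (e t : ℝ) : ‖phase e t‖ = 1 := by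
  rw [phase, show -(Complex.I * e * t) = ((-(e * t) : ℝ) : ℂ) * Complex.I by push_cast; ring,
    Complex.norm_exp_ofReal_mul_I]

theorem conj_phase_mul_phase (e t : ℝ) : starRingEnd ℂ (phase e t) * phase e t = 1 := by
  rw [mul_comm, Complex.mul_conj, Complex.normSq_eq_norm_sq, norm_phase]
  simp

theorem phase_zero (e : ℝ) : phase e 0 = 1 := by simp [phase]

theorem phase_add (e s t : ℝ) : phase e (s + t) = phase e s * phase e t := by
  rw [phase, phase, phase, ← Complex.exp_add]
  push_cast
  ring_nf

theorem hasDerivAt_phase (e t : ℝ) :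
    HasDerivAt (phase e) (-(Complex.I * e) * phase e t) t := by
  have h : HasDerivAt (fun t : ℝ => -(Complex.I * e * t)) (-(Complex.I * e)) t :=
    ((Complex.ofRealCLM.hasDerivAt (x := t)).const_mul (Complex.I * e)).neg.congr_deriv (by simp)
  exact h.cexp.congr_deriv (mul_comm _ _)

theorem continuous_phase (e : ℝ) : Continuous (phase e) := by
  unfold phase
  fun_prop

variable {ι : Type*} (b : HilbertBasis ι ℂ E) (e : ι → ℝ)

theorem orthonormal_phase_smul (t : ℝ) : Orthonormal ℂ fun i => phase (e i) t • b i := by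
  constructor
  · intro i
    rw [norm_smul, norm_phase, one_mul, b.orthonormal.1 i]
  · intro i j hij
    dsimp only
    rw [inner_smul_left, inner_smul_right, b.orthonormal.2 hij, mul_zero, mul_zero]

theorem orthogonal_span_phase_smul (t : ℝ) :
    (Submodule.span ℂ (Set.range fun i => phase (e i) t • b i))ᗮ = ⊥ := by
  rw [eq_bot_iff]
  intro x hx
  rw [Submodule.mem_orthogonal] at hx
  refine hilbertBasis_ext b fun i => ?_
  have h := hx _ (Submodule.subset_span ⟨i, rfl⟩)
  dsimp only at h
  rw [inner_smul_left] at h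
  have h2 : starRingEnd ℂ (phase (e i) t) ≠ 0 :=
    left_ne_zero_of_mul_eq_one (conj_phase_mul_phase (e i) t)
  rw [inner_zero_right]
  exact (mul_eq_zero.1 h).resolve_left h2

variable [CompleteSpace E]

/-- The unitary operator that multiplies the `i`-th basis vector by `exp (-i eᵢ t)`. -/
def evolution (t : ℝ) : E ≃ₗᵢ[ℂ] E :=
  b.repr.trans (HilbertBasis.mkOfOrthogonalEqBot (orthonormal_phase_smul b e t)
    (orthogonal_span_phase_smul b e t)).repr.symm

theorem inner_evolution (t : ℝ) (x : E) (i : ι) :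
    inner ℂ (b i) (evolution b e t x) = phase (e i) t * inner ℂ (b i) x := by
  have h := HilbertBasis.repr_apply_apply
    (HilbertBasis.mkOfOrthogonalEqBot (orthonormal_phase_smul b e t)
      (orthogonal_span_phase_smul b e t)) (evolution b e t x) i
  rw [evolution, LinearIsometryEquiv.trans_apply, LinearIsometryEquiv.apply_symm_apply,
    HilbertBasis.coe_mkOfOrthogonalEqBot, inner_smul_left, b.repr_apply_apply] at h
  rw [h, ← mul_assoc, mul_comm (phase _ _), conj_phase_mul_phase, one_mul]
  rfl

/-- The evolution acts on the eigenvectors of an operator that is diagonal in the basis. -/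
theorem evolution_eigenvector (T : E →L[ℂ] E) (hs : (T : E →ₗ[ℂ] E).IsSymmetric) (τ : ι → ℝ)
    (hb : ∀ i, T (b i) = (τ i : ℂ) • b i) (h : ℝ → ℝ) {x : E} {μ : ℝ} (hx : T x = (μ : ℂ) • x)
    (t : ℝ) : evolution b (fun i => h (τ i)) t x = phase (h μ) t • x := by
  refine hilbertBasis_ext b fun i => ?_
  rw [inner_evolution, inner_smul_right]
  -- If `τ i ≠ μ`, symmetry of `T` forces `b i ⟂ x`, so only basis vectors with the phase `h μ`
  -- contribute to `x`.
  by_cases hi : τ i = μ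
  · rw [hi]
  · have h1 : inner ℂ (T (b i)) x = inner ℂ (b i) (T x) := hs (b i) x
    rw [hb, hx, inner_smul_left, inner_smul_right, Complex.conj_ofReal, ← sub_eq_zero,
      ← sub_mul] at h1
    have h2 : ((τ i : ℂ) - μ) ≠ 0 := by
      rw [← Complex.ofReal_sub]
      exact_mod_cast sub_ne_zero.2 hi
    rw [(mul_eq_zero.1 h1).resolve_left h2]
    simp

theorem evolution_basis (t : ℝ) (i : ι) : evolution b e t (b i) = phase (e i) t • b i := by
  classical
  refine hilbertBasis_ext b fun j => ?_
  rw [inner_evolution, inner_smul_right, orthonormal_iff_ite.1 b.orthonormal]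
  split_ifs with h
  · rw [h]
  · simp

theorem evolution_zero (x : E) : evolution b e 0 x = x :=
  hilbertBasis_ext b fun i => by rw [inner_evolution, phase_zero, one_mul]

theorem evolution_add (s t : ℝ) (x : E) :
    evolution b e (s + t) x = evolution b e s (evolution b e t x) :=
  hilbertBasis_ext b fun i => by simp only [inner_evolution, phase_add, mul_assoc]

theorem continuous_evolution (x : E) : Continuous fun t => evolution b e t x := by
  refine hilbertBasis_induction b (P := fun x => Continuous fun t => evolution b e t x)
    (fun i => ?_) ?_ (fun x y hx hy => ?_) (fun a x hx => ?_) (fun x hx => ?_) x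
  · simp only [evolution_basis]
    exact (continuous_phase _).smul continuous_const
  · simp only [map_zero]
    exact continuous_const
  · simp only [map_add]
    exact hx.add hy
  · simp only [map_smul]
    exact hx.const_smul a
  · refine continuous_of_uniform_approx_of_continuous fun u hu => ?_
    obtain ⟨ε, hε, hεu⟩ := Metric.mem_uniformity_dist.1 hu
    obtain ⟨y, hy, hxy⟩ := hx ε hε
    refine ⟨_, hy, fun t => hεu ?_⟩
    rwa [dist_eq_norm, ← map_sub, LinearIsometryEquiv.norm_map]

/-- This identifies the exact domain of the generator. For the converse, the relation between
coefficients integrates to `U_t x = x + ∫₀ᵗ U_s (-i y) ds`, and the integral of a continuous orbit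
is differentiable; no series of difference quotients has to be dominated. -/
theorem hasDerivAt_evolution_iff (x y : E) :
    HasDerivAt (fun t => evolution b e t x) (-(Complex.I • y)) 0 ↔
      ∀ i, inner ℂ (b i) y = (e i : ℂ) * inner ℂ (b i) x := by
  constructor
  · intro h i
    have h1 := ((innerSL ℂ (b i)).restrictScalars ℝ).hasFDerivAt.comp_hasDerivAt 0 h
    have h2 : HasDerivAt (fun t => phase (e i) t * inner ℂ (b i) x)
        (-(Complex.I * e i) * inner ℂ (b i) x) 0 := by
      have := (hasDerivAt_phase (e i) 0).mul_const (inner ℂ (b i) x)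
      rwa [phase_zero, mul_one] at this
    have h3 : (fun t => phase (e i) t * inner ℂ (b i) x)
        = ((innerSL ℂ (b i)).restrictScalars ℝ) ∘ fun t => evolution b e t x := by
      funext t
      simp [inner_evolution]
    rw [h3] at h2
    have h4 := h1.unique h2
    simp only [ContinuousLinearMap.coe_restrictScalars', innerSL_apply_apply, inner_neg_right,
      inner_smul_right] at h4
    have h5 : Complex.I * (inner ℂ (b i) y) = Complex.I * (e i * inner ℂ (b i) x) := by
      linear_combination -h4
    exact mul_left_cancel₀ Complex.I_ne_zero h5
  · intro h
    have hc : Continuous fun s => evolution b e s (-(Complex.I • y)) := continuous_evolution b e _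
    have key : (fun t => evolution b e t x)
        = fun t => x + ∫ s in (0 : ℝ)..t, evolution b e s (-(Complex.I • y)) := by
      funext t
      refine hilbertBasis_ext b fun i => ?_
      have h1 := ((innerSL ℂ (b i)).restrictScalars ℝ).intervalIntegral_comp_comm
        (hc.intervalIntegrable (μ := volume) 0 t)
      simp only [ContinuousLinearMap.coe_restrictScalars', innerSL_apply_apply] at h1
      rw [inner_add_right, ← h1]
      simp only [inner_evolution, inner_neg_right, inner_smul_right, h i]
      have h2 : ∀ s ∈ Set.uIcc 0 t, HasDerivAt (fun s => phase (e i) s * inner ℂ (b i) x)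
          (phase (e i) s * -(Complex.I * (e i * inner ℂ (b i) x))) s := fun s _ =>
        ((hasDerivAt_phase (e i) s).mul_const (inner ℂ (b i) x)).congr_deriv (by ring)
      rw [intervalIntegral.integral_eq_sub_of_hasDerivAt h2
        (((continuous_phase _).mul continuous_const).intervalIntegrable _ _), phase_zero]
      ring
    rw [key]
    have h2 := (hc.integral_hasStrictDerivAt 0 0).hasDerivAt.const_add x
    rwa [evolution_zero] at h2

/-- A one-parameter unitary group is determined by its derivative on an eigenbasis. -/
theorem eq_evolution (W : ℝ → (E ≃ₗᵢ[ℂ] E)) (h0 : ∀ x, W 0 x = x)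
    (hadd : ∀ s t x, W (s + t) x = W s (W t x))
    (hder : ∀ i, HasDerivAt (fun t => W t (b i)) (-(Complex.I • ((e i : ℂ) • b i))) 0) :
    W = evolution b e := by
  have hbasis : ∀ t i, W t (b i) = phase (e i) t • b i := by
    intro t i
    have hd : ∀ t, HasDerivAt (fun t => W t (b i))
        (-((Complex.I * e i) • W t (b i))) t := by
      intro t
      have h1 := ((W t).toContinuousLinearEquiv.toContinuousLinearMap.restrictScalars
        ℝ).hasFDerivAt.comp_hasDerivAt 0 (hder i)
      have h2 : HasDerivAt (fun s => W (t + s) (b i)) (-((Complex.I * e i) • W t (b i))) 0 := by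
        convert h1 using 1
        · funext s
          rw [hadd]
          rfl
        · change _ = W t (-(Complex.I • ((e i : ℂ) • b i)))
          rw [map_neg, map_smul, map_smul, smul_smul]
      have h3 : HasDerivAt (fun s => W (t + s) (b i)) (-((Complex.I * e i) • W t (b i)))
          (t - t) := by rwa [sub_self]
      have h4 := h3.comp_sub_const t t
      simpa using h4
    -- The group law has moved the derivative from `0` to every `t`; the opposite phase then makes
    -- the orbit of `b i` constant.
    have hp : ∀ t, HasDerivAt (fun t => phase (-(e i)) t • W t (b i)) 0 t := by
      intro t
      refine ((hasDerivAt_phase (-(e i)) t).smul (hd t)).congr_deriv ?_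
      rw [Complex.ofReal_neg]
      module
    have hconst := is_const_of_deriv_eq_zero (fun t => (hp t).differentiableAt)
      (fun t => (hp t).deriv) t 0
    rw [h0, phase_zero, one_smul] at hconst
    conv_rhs => rw [← hconst, smul_smul]
    have : phase (e i) t * phase (-(e i)) t = 1 := by
      rw [phase, phase, ← Complex.exp_add]
      simp
    rw [this, one_smul]
  funext t
  ext x
  refine hilbertBasis_induction b (P := fun x => W t x = evolution b e t x) (fun i => ?_) (by simp)
    (fun x y hx hy => by simp [hx, hy]) (fun a x hx => by simp [hx]) (fun x hx => ?_) x
  · rw [hbasis, evolution_basis]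
  · rw [← sub_eq_zero, ← norm_eq_zero]
    refine le_antisymm (le_of_forall_pos_lt_add fun ε hε => ?_) (norm_nonneg _)
    obtain ⟨y, hy, hxy⟩ := hx (ε / 2) (by positivity)
    calc ‖W t x - evolution b e t x‖
        = ‖W t (x - y) - evolution b e t (x - y)‖ := by simp [hy]
      _ ≤ ‖W t (x - y)‖ + ‖evolution b e t (x - y)‖ := norm_sub_le _ _
      _ < 0 + ε := by
        rw [LinearIsometryEquiv.norm_map, LinearIsometryEquiv.norm_map]
        linarith

/-- The time average of `f` over `[0, t]` converges as `t → ∞`. -/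
def HasTimeMean (f : ℝ → ℂ) : Prop :=
  ∃ m, Tendsto (fun t : ℝ => ((1 / t : ℝ) : ℂ) * ∫ s in (0 : ℝ)..t, f s) atTop (𝓝 m)

theorem HasTimeMean.add {f g : ℝ → ℂ} (hf : HasTimeMean f) (hg : HasTimeMean g)
    (hfc : Continuous f) (hgc : Continuous g) : HasTimeMean fun s => f s + g s := by
  obtain ⟨m, hm⟩ := hf
  obtain ⟨n, hn⟩ := hg
  refine ⟨m + n, (hm.add hn).congr fun t => ?_⟩
  rw [intervalIntegral.integral_add (hfc.intervalIntegrable _ _) (hgc.intervalIntegrable _ _),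
    mul_add]

theorem HasTimeMean.const_mul {f : ℝ → ℂ} (hf : HasTimeMean f) (a : ℂ) :
    HasTimeMean fun s => a * f s := by
  obtain ⟨m, hm⟩ := hf
  refine ⟨a * m, (hm.const_mul a).congr fun t => ?_⟩
  rw [intervalIntegral.integral_const_mul]
  ring

/-- For `e ≠ 0` the primitive of the phase is bounded by `2 / |e|`, so the average decays like `1 /
t`; for `e = 0` the average is `1`. -/
theorem hasTimeMean_phase (e : ℝ) : HasTimeMean (phase e) := by
  by_cases he : e = 0
  · refine ⟨1, tendsto_const_nhds.congr' ?_⟩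
    filter_upwards [eventually_gt_atTop 0] with t ht
    have : (t : ℂ) ≠ 0 := by exact_mod_cast ht.ne'
    simp [phase, he, this]
  · refine ⟨0, ?_⟩
    have hne : -(Complex.I * e) ≠ 0 := by simp [he]
    have h1 : ∀ t : ℝ, ∫ s in (0 : ℝ)..t, phase e s = (phase e t - 1) / (-(Complex.I * e)) := by
      intro t
      have h2 : ∀ s ∈ Set.uIcc 0 t, HasDerivAt (fun s => phase e s / (-(Complex.I * e)))
          (phase e s) s := fun s _ =>
        ((hasDerivAt_phase e s).div_const (-(Complex.I * e))).congr_deriv (by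
          rw [mul_comm, mul_div_cancel_right₀ _ hne])
      rw [intervalIntegral.integral_eq_sub_of_hasDerivAt h2
        ((continuous_phase e).intervalIntegrable _ _), phase_zero, sub_div]
    rw [tendsto_zero_iff_norm_tendsto_zero]
    have h3 : Tendsto (fun t : ℝ => 1 / t * (2 / |e|)) atTop (𝓝 0) := by
      have := (tendsto_inv_atTop_zero (𝕜 := ℝ)).mul_const (2 / |e|)
      simpa using this
    refine squeeze_zero' (Eventually.of_forall fun t => norm_nonneg _) ?_ h3
    filter_upwards [eventually_gt_atTop 0] with t ht
    rw [h1, norm_mul, Complex.norm_real, Real.norm_of_nonneg (by positivity)]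
    refine mul_le_mul_of_nonneg_left ?_ (by positivity)
    rw [norm_div]
    have h4 : ‖phase e t - 1‖ ≤ 2 := by
      refine (norm_sub_le _ _).trans ?_
      rw [norm_phase]
      norm_num
    have h5 : ‖-(Complex.I * (e : ℂ))‖ = |e| := by simp
    rw [h5]
    gcongr

theorem norm_timeMean_sub_le {f g : ℝ → ℂ} (hf : Continuous f) (hg : Continuous g) {ε t : ℝ}
    (ht : 0 < t) (h : ∀ s, ‖f s - g s‖ ≤ ε) :
    ‖((1 / t : ℝ) : ℂ) * (∫ s in (0 : ℝ)..t, f s) - ((1 / t : ℝ) : ℂ) * ∫ s in (0 : ℝ)..t, g s‖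
      ≤ ε := by
  rw [← mul_sub, ← intervalIntegral.integral_sub (hf.intervalIntegrable _ _)
    (hg.intervalIntegrable _ _), norm_mul, Complex.norm_real, Real.norm_of_nonneg (by positivity)]
  have := intervalIntegral.norm_integral_le_of_norm_le_const (a := 0) (b := t)
    (f := fun s => f s - g s) (C := ε) fun s _ => h s
  rw [sub_zero, abs_of_pos ht] at this
  calc 1 / t * ‖∫ s in (0 : ℝ)..t, f s - g s‖ ≤ 1 / t * (ε * t) := by gcongr
    _ = ε := by field_simp

/-- Averaging over `[0, t]` is a contraction for the supremum norm. The limit is not known in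
advance, so the Cauchy criterion is used; the two averages of `f` are compared through two averages
of `g` and their limit, in four steps of `ε / 4`. -/
theorem hasTimeMean_of_approx {f : ℝ → ℂ} (hf : Continuous f)
    (h : ∀ ε > 0, ∃ g, Continuous g ∧ HasTimeMean g ∧ ∀ s, ‖f s - g s‖ ≤ ε) : HasTimeMean f := by
  refine cauchy_map_iff_exists_tendsto.1 ?_
  rw [Metric.cauchy_iff]
  refine ⟨by infer_instance, fun ε hε => ?_⟩
  obtain ⟨g, hgc, ⟨m, hm⟩, hfg⟩ := h (ε / 4) (by positivity)
  have hev := (Metric.tendsto_nhds.1 hm (ε / 4) (by positivity)).and (eventually_gt_atTop 0)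
  refine ⟨_, image_mem_map hev, ?_⟩
  rintro _ ⟨s, ⟨hs, hs0⟩, rfl⟩ _ ⟨t, ⟨ht, ht0⟩, rfl⟩
  have h1 := norm_timeMean_sub_le hf hgc hs0 hfg
  have h2 := norm_timeMean_sub_le hf hgc ht0 hfg
  rw [← dist_eq_norm] at h1 h2
  have h3 := dist_triangle4 (((1 / s : ℝ) : ℂ) * ∫ r in (0 : ℝ)..s, f r)
    (((1 / s : ℝ) : ℂ) * ∫ r in (0 : ℝ)..s, g r) m (((1 / t : ℝ) : ℂ) * ∫ r in (0 : ℝ)..t, f r)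
  have h4 := dist_triangle m (((1 / t : ℝ) : ℂ) * ∫ r in (0 : ℝ)..t, g r)
    (((1 / t : ℝ) : ℂ) * ∫ r in (0 : ℝ)..t, f r)
  rw [dist_comm] at h2 ht
  dsimp only
  linarith

theorem continuous_inner_evolution (X : E →L[ℂ] E) (x y : E) :
    Continuous fun s => inner ℂ (evolution b e s x) (X (evolution b e s y)) :=
  (continuous_evolution b e x).inner (X.continuous.comp (continuous_evolution b e y))

/-- Matrix elements of a bounded operator have an infinite-time average under an evolution with
pure point spectrum. -/
theorem hasTimeMean_inner_evolution (X : E →L[ℂ] E) (x y : E) :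
    HasTimeMean fun s => inner ℂ (evolution b e s x) (X (evolution b e s y)) := by
  -- Between eigenvectors the matrix element is a constant times a phase of frequency `e j - e i`.
  -- General vectors follow by approximation, one argument at a time, with `hbound` uniform in `s`.
  have hbb : ∀ i j, HasTimeMean fun s =>
      inner ℂ (evolution b e s (b i)) (X (evolution b e s (b j))) := by
    intro i j
    have := (hasTimeMean_phase (e j - e i)).const_mul (inner ℂ (b i) (X (b j)))
    convert this using 2 with s
    rw [evolution_basis, evolution_basis, map_smul, inner_smul_left, inner_smul_right, phase,
      phase, phase, ← Complex.exp_conj, ← mul_assoc, ← Complex.exp_add, mul_comm]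
    congr 2
    simp
    ring
  have hbound : ∀ (u v : E) (s : ℝ), ‖inner ℂ (evolution b e s u) (X (evolution b e s v))‖
      ≤ ‖u‖ * (‖X‖ * ‖v‖) := by
    intro u v s
    refine (norm_inner_le_norm _ _).trans ?_
    rw [LinearIsometryEquiv.norm_map]
    refine mul_le_mul_of_nonneg_left ?_ (norm_nonneg _)
    refine (X.le_opNorm _).trans ?_
    rw [LinearIsometryEquiv.norm_map]
  have hright : ∀ i y, HasTimeMean fun s =>
      inner ℂ (evolution b e s (b i)) (X (evolution b e s y)) := by
    intro i y
    refine hilbertBasis_induction b (P := fun y => HasTimeMean fun s =>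
      inner ℂ (evolution b e s (b i)) (X (evolution b e s y))) (hbb i) ?_
      (fun y z hy hz => ?_) (fun a y hy => ?_) (fun y hy => ?_) y
    · simpa using (hasTimeMean_phase 0).const_mul 0
    · simp only [map_add, inner_add_right]
      exact hy.add hz (continuous_inner_evolution b e X _ _) (continuous_inner_evolution b e X _ _)
    · simp only [map_smul, inner_smul_right]
      exact hy.const_mul a
    · refine hasTimeMean_of_approx (continuous_inner_evolution b e X _ _) fun ε hε => ?_
      obtain ⟨z, hz, hyz⟩ := hy (ε / (‖b i‖ * ‖X‖ + 1)) (by positivity)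
      refine ⟨_, continuous_inner_evolution b e X _ _, hz, fun s => ?_⟩
      rw [← inner_sub_right, ← map_sub, ← map_sub]
      refine (hbound _ _ _).trans ?_
      rw [lt_div_iff₀ (by positivity)] at hyz
      nlinarith [norm_nonneg (y - z)]
  refine hilbertBasis_induction b (P := fun x => HasTimeMean fun s =>
    inner ℂ (evolution b e s x) (X (evolution b e s y))) (fun i => hright i y) ?_
    (fun x z hx hz => ?_) (fun a x hx => ?_) (fun x hx => ?_) x
  · simpa using (hasTimeMean_phase 0).const_mul 0
  · simp only [map_add, inner_add_left]
    exact hx.add hz (continuous_inner_evolution b e X _ _) (continuous_inner_evolution b e X _ _)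
  · simp only [map_smul, inner_smul_left]
    exact hx.const_mul _
  · refine hasTimeMean_of_approx (continuous_inner_evolution b e X _ _) fun ε hε => ?_
    obtain ⟨z, hz, hxz⟩ := hx (ε / (‖X‖ * ‖y‖ + 1)) (by positivity)
    refine ⟨_, continuous_inner_evolution b e X _ _, hz, fun s => ?_⟩
    rw [← inner_sub_left, ← map_sub]
    refine (hbound _ _ _).trans ?_
    rw [lt_div_iff₀ (by positivity)] at hxz
    nlinarith [norm_nonneg (x - z)]

end Evolution

universe u

/-- The Hilbert space completion of a space with a positive semidefinite Hermitian form. -/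
theorem exists_hilbert_completion {V : Type u} [AddCommGroup V] [Module ℂ V]
    (c : PreInnerProductSpace.Core ℂ V) :
    ∃ (Q : Type u) (_ : NormedAddCommGroup Q) (_ : InnerProductSpace ℂ Q) (_ : CompleteSpace Q)
      (j : V →ₗ[ℂ] Q), DenseRange j ∧ ∀ x y, inner ℂ (j x) (j y) = c.inner x y := by
  let _ : SeminormedAddCommGroup V := InnerProductSpace.Core.toSeminormedAddCommGroup (𝕜 := ℂ)
  let _ : InnerProductSpace ℂ V := InnerProductSpace.ofCore c
  refine ⟨UniformSpace.Completion V, inferInstance, inferInstance, inferInstance,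
    (UniformSpace.Completion.toComplₗᵢ (𝕜 := ℂ) (E := V)).toLinearMap,
    UniformSpace.Completion.denseRange_coe, fun x y => ?_⟩
  exact UniformSpace.Completion.inner_coe x y

/-! ### Plane waves and antisymmetric amplitudes. -/

section Fourier

variable {N : ℕ}

/-- The plane waves as a Hilbert basis. -/
def planeWaveBasis (N : ℕ) : HilbertBasis (Mode N) ℂ (WaveSpace N) :=
  UnitAddTorus.mFourierBasis

theorem planeWaveBasis_apply (k : Mode N) : planeWaveBasis N k = planeWave k :=
  congrFun UnitAddTorus.coe_mFourierBasis k

theorem inner_planeWave (k l : Mode N) [Decidable (k = l)] :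
    inner ℂ (planeWave k) (planeWave l) = if k = l then 1 else 0 := by
  classical
  have := orthonormal_iff_ite.1 (planeWaveBasis N).orthonormal k l
  rw [planeWaveBasis_apply, planeWaveBasis_apply] at this
  convert this

theorem amplitude_ext {ψ φ : WaveSpace N} (h : ∀ k, amplitude ψ k = amplitude φ k) : ψ = φ :=
  hilbertBasis_ext (planeWaveBasis N) fun k => by
    rw [planeWaveBasis_apply]
    exact h k

theorem continuous_amplitude (k : Mode N) : Continuous fun ψ : WaveSpace N => amplitude ψ k :=
  (innerSL ℂ (planeWave k)).continuous

theorem hasSum_conj_amplitude_mul (ψ φ : WaveSpace N) :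
    HasSum (fun k => starRingEnd ℂ (amplitude ψ k) * amplitude φ k) (inner ℂ ψ φ) := by
  have := (planeWaveBasis N).hasSum_inner_mul_inner ψ φ
  simpa only [planeWaveBasis_apply, amplitude, inner_conj_symm] using this

theorem hasSum_norm_amplitude_sq (ψ : WaveSpace N) :
    HasSum (fun k => ‖amplitude ψ k‖ ^ 2) (‖ψ‖ ^ 2) := by
  have h := hasSum_conj_amplitude_mul ψ ψ
  rw [inner_self_eq_norm_sq_to_K] at h
  have h2 := Complex.hasSum_re h
  convert h2 using 1
  · funext k
    rw [mul_comm, Complex.mul_conj, Complex.ofReal_re, Complex.normSq_eq_norm_sq]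
  · norm_cast

/-- `TrigPoly.toWave` as a linear map. -/
def toWaveₗ (N : ℕ) : TrigPoly N →ₗ[ℂ] WaveSpace N := Finsupp.linearCombination ℂ planeWave

theorem toWaveₗ_apply (c : TrigPoly N) : toWaveₗ N c = c.toWave := rfl

theorem amplitude_toWave (c : TrigPoly N) (k : Mode N) : amplitude c.toWave k = c k := by
  classical
  rw [amplitude, TrigPoly.toWave, Finsupp.sum, inner_sum]
  simp only [inner_smul_right, inner_planeWave, mul_ite, mul_one, mul_zero, Finset.sum_ite_eq,
    Finsupp.mem_support_iff]
  split_ifs with h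
  · rfl
  · exact (not_not.1 h).symm

theorem norm_toWave_sq (c : TrigPoly N) : ‖c.toWave‖ ^ 2 = c.sum fun _ a => ‖a‖ ^ 2 := by
  have h := hasSum_norm_amplitude_sq c.toWave
  simp only [amplitude_toWave] at h
  refine h.unique (hasSum_sum_of_ne_finset_zero fun k hk => ?_)
  rw [Finsupp.notMem_support_iff.1 hk]
  simp

/-- Antisymmetric finite combinations of plane waves. -/
def antisymmPoly (N : ℕ) : Submodule ℂ (TrigPoly N) where
  carrier := {c | c.IsAntisymm}
  add_mem' := by
    intro c d hc hd σ k
    rw [Finsupp.add_apply, Finsupp.add_apply, hc σ k, hd σ k, mul_add]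
  zero_mem' := by
    intro σ k
    simp
  smul_mem' := by
    intro a c hc σ k
    rw [Finsupp.smul_apply, Finsupp.smul_apply, hc σ k, smul_eq_mul, smul_eq_mul]
    ring

theorem csign_mul_self (σ : Equiv.Perm (Fin N)) : csign σ * csign σ = 1 := by
  rcases Int.units_eq_one_or (Equiv.Perm.sign σ) with h | h <;> simp [csign, h]

theorem conj_csign (σ : Equiv.Perm (Fin N)) : starRingEnd ℂ (csign σ) = csign σ := by
  rcases Int.units_eq_one_or (Equiv.Perm.sign σ) with h | h <;> simp [csign, h]

theorem amplitude_relabel {ψ : WaveSpace N} (hψ : ψ ∈ fermionSpace N) (σ : Equiv.Perm (Fin N))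
    (k : Mode N) : amplitude ψ (relabel σ k) = csign σ * amplitude ψ k := by
  rw [amplitude, ← (permute σ).inner_map_map, permute_planeWave, hψ σ, inner_smul_right]
  rfl

theorem isClosed_fermionSpace (N : ℕ) : IsClosed (fermionSpace N : Set (WaveSpace N)) := by
  have : (fermionSpace N : Set (WaveSpace N))
      = ⋂ σ : Equiv.Perm (Fin N), {ψ | permute σ ψ = csign σ • ψ} := by
    ext ψ
    simp [fermionSpace]
  rw [this]
  exact isClosed_iInter fun σ => isClosed_eq (permute σ).continuous (continuous_const_smul _)

instance (N : ℕ) : CompleteSpace (fermionSpace N) :=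
  (isClosed_fermionSpace N).completeSpace_coe

/-- The type of antisymmetric finite combinations of plane waves. -/
def AntisymmPoly (N : ℕ) : Type := antisymmPoly N

instance (N : ℕ) : AddCommGroup (AntisymmPoly N) := inferInstanceAs (AddCommGroup (antisymmPoly N))

instance (N : ℕ) : Module ℂ (AntisymmPoly N) := inferInstanceAs (Module ℂ (antisymmPoly N))

/-- The coefficients of an antisymmetric combination, as a linear map. -/
def AntisymmPoly.toPoly (N : ℕ) : AntisymmPoly N →ₗ[ℂ] TrigPoly N := (antisymmPoly N).subtype

instance (N : ℕ) : CoeOut (AntisymmPoly N) (TrigPoly N) := ⟨AntisymmPoly.toPoly N⟩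

theorem AntisymmPoly.isAntisymm (c : AntisymmPoly N) : (c : TrigPoly N).IsAntisymm := c.2

theorem TrigPoly.IsAntisymm.exists_eq {c : TrigPoly N} (hc : c.IsAntisymm) :
    ∃ c' : AntisymmPoly N, (c' : TrigPoly N) = c := ⟨⟨c, hc⟩, rfl⟩

/-- `TrigPoly.toWave` from antisymmetric combinations to the fermion space. -/
def toFermion (N : ℕ) : AntisymmPoly N →ₗ[ℂ] fermionSpace N :=
  ((toWaveₗ N).comp (AntisymmPoly.toPoly N)).codRestrict (fermionSpace N)
    fun c => TrigPoly.IsAntisymm.toWave_mem c.isAntisymm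

theorem coe_toFermion (c : AntisymmPoly N) :
    (toFermion N c : WaveSpace N) = (c : TrigPoly N).toWave := rfl

/-- The antisymmetrization of a plane wave. -/
def antisymmetrize (k : Mode N) : TrigPoly N :=
  ∑ σ : Equiv.Perm (Fin N), Finsupp.single (relabel σ k) (csign σ)

theorem antisymmetrize_isAntisymm (k : Mode N) : (antisymmetrize k).IsAntisymm := by
  classical
  intro τ l
  have hmul : ∀ σ, relabel (σ * τ) k = relabel τ (relabel σ k) := by
    intro σ
    funext i
    cases i <;> rfl
  have hinj : Function.Injective (relabel τ : Mode N → Mode N) := fun a b h =>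
    (Equiv.optionCongr τ).surjective.injective_comp_right h
  have hcs : ∀ σ, csign (σ * τ) = csign τ * csign σ := by
    intro σ
    simp [csign, mul_comm]
  simp only [antisymmetrize, Finsupp.finsetSum_apply, Finset.mul_sum]
  rw [← Equiv.sum_comp (Equiv.mulRight τ)]
  refine Finset.sum_congr rfl fun σ _ => ?_
  rw [Equiv.coe_mulRight, hmul, hcs, Finsupp.single_apply, Finsupp.single_apply]
  simp only [hinj.eq_iff, mul_ite, mul_zero]

/-- A fermionic state orthogonal to all antisymmetric trigonometric polynomials vanishes. -/
theorem eq_zero_of_inner_toWave_eq_zero (ψ : fermionSpace N)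
    (h : ∀ c : TrigPoly N, c.IsAntisymm → inner ℂ c.toWave (ψ : WaveSpace N) = 0) : ψ = 0 := by
  apply Subtype.ext
  refine amplitude_ext fun k => ?_
  have h1 := h _ (antisymmetrize_isAntisymm k)
  have h2 : (antisymmetrize k).toWave
      = ∑ σ : Equiv.Perm (Fin N), csign σ • planeWave (relabel σ k) := by
    rw [← toWaveₗ_apply, antisymmetrize, map_sum]
    refine Finset.sum_congr rfl fun σ _ => ?_
    rw [toWaveₗ, Finsupp.linearCombination_single]
  rw [h2, sum_inner] at h1
  -- The sign occurs once in the antisymmetrized wave and once in the amplitude of `ψ`; hence all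
  -- `N!` terms are equal and cannot cancel.
  have h3 : ∀ σ : Equiv.Perm (Fin N),
      inner ℂ (csign σ • planeWave (relabel σ k)) (ψ : WaveSpace N)
        = amplitude (ψ : WaveSpace N) k := by
    intro σ
    rw [inner_smul_left, conj_csign]
    change csign σ * amplitude (ψ : WaveSpace N) (relabel σ k) = _
    rw [amplitude_relabel ψ.2, ← mul_assoc, csign_mul_self, one_mul]
  simp only [h3, Finset.sum_const, nsmul_eq_mul] at h1
  have h4 : ((Finset.univ : Finset (Equiv.Perm (Fin N))).card : ℂ) ≠ 0 := by
    exact_mod_cast Finset.card_ne_zero_of_mem (Finset.mem_univ 1)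
  rw [(mul_eq_zero.1 h1).resolve_left h4]
  simp [amplitude]

/-- An antisymmetric amplitude vanishes unless the fermion momenta are distinct. -/
theorem TrigPoly.IsAntisymm.injective {c : TrigPoly N} (hc : c.IsAntisymm) {k : Mode N}
    (hk : c k ≠ 0) : Function.Injective fun n : Fin N => k (some n) := by
  intro a b hab
  by_contra hne
  -- Exchanging two equal momenta fixes the mode but changes the sign of its amplitude.
  have h := hc (Equiv.swap a b) k
  have h1 : relabel (Equiv.swap a b) k = k := by
    funext i
    cases i with
    | none => rfl
    | some n =>
      change k (some (Equiv.swap a b n)) = k (some n)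
      by_cases ha : n = a
      · rw [ha, Equiv.swap_apply_left]; exact hab.symm
      · by_cases hb : n = b
        · rw [hb, Equiv.swap_apply_right]; exact hab
        · rw [Equiv.swap_apply_of_ne_of_ne ha hb]
  rw [h1, csign, Equiv.Perm.sign_swap hne] at h
  apply hk
  push_cast at h
  linear_combination h / 2

end Fourier

/-! ### Sesquilinearity and positivity of the energy form. -/

section Eval

variable {N : ℕ}

theorem TrigPoly.eval_add (c d : TrigPoly N) (x : Config N) :
    (c + d).eval x = c.eval x + d.eval x :=
  Finsupp.sum_add_index' (by simp) (by intros; ring)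

theorem TrigPoly.eval_smul (a : ℂ) (c : TrigPoly N) (x : Config N) :
    (a • c).eval x = a * c.eval x := by
  rw [TrigPoly.eval, TrigPoly.eval, Finsupp.sum_smul_index' (by simp), Finsupp.mul_sum]
  simp only [smul_eq_mul, mul_assoc]

theorem TrigPoly.continuous_eval (c : TrigPoly N) : Continuous c.eval := by
  unfold TrigPoly.eval Finsupp.sum
  fun_prop

theorem TrigPoly.norm_eval_le (c : TrigPoly N) (x : Config N) :
    ‖c.eval x‖ ≤ c.sum fun _ a => ‖a‖ := by
  refine (norm_sum_le _ _).trans (Finset.sum_le_sum fun k _ => ?_)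
  rw [norm_mul]
  have := (UnitAddTorus.mFourier k).norm_coe_le_norm x
  rw [UnitAddTorus.mFourier_norm] at this
  exact mul_le_of_le_one_right (norm_nonneg _) this

end Eval

namespace System

variable (S : System)

/-- The configuration in which the `n`-th fermion is at distance `y` from the impurity. -/
def contact (n : Fin S.N) (z : Config S.N × ℝ) : Config S.N :=
  Function.update z.1 (some n) (z.1 none + ((z.2 / S.L : ℝ) : UnitAddCircle))

theorem continuous_contact (n : Fin S.N) : Continuous (S.contact n) := by
  refine Continuous.update continuous_fst _ ?_
  refine (continuous_apply none |>.comp continuous_fst).add ?_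
  exact (AddCircle.continuous_mk' 1).comp (continuous_snd.div_const _)

/-- The interaction with the `n`-th fermion, without the factor `1/L`. -/
def contactForm (n : Fin S.N) (c d : TrigPoly S.N) : ℂ :=
  ∫ z, starRingEnd ℂ (c.eval (S.contact n z)) * d.eval (S.contact n z)
    ∂((configMeasure S.N).prod S.U)

theorem freeForm_eq (c d : TrigPoly S.N) (s : Finset (Mode S.N)) (hs : d.support ⊆ s) :
    (d.sum fun k a => starRingEnd ℂ (c k) * (S.freeEnergy k : ℂ) * a)
      = ∑ k ∈ s, starRingEnd ℂ (c k) * (S.freeEnergy k : ℂ) * d k :=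
  Finsupp.sum_of_support_subset _ hs _ (by simp)

theorem re_energyForm_self (c : TrigPoly S.N) :
    (S.energyForm c c).re
      = (c.sum fun k a => S.freeEnergy k * ‖a‖ ^ 2) + (S.potentialForm c c).re := by
  rw [energyForm, Complex.add_re, Finsupp.sum, Finsupp.sum, Complex.re_sum]
  congr 1
  refine Finset.sum_congr rfl fun k _ => ?_
  rw [mul_right_comm, mul_comm (starRingEnd ℂ _), Complex.mul_conj, Complex.normSq_eq_norm_sq,
    ← Complex.ofReal_mul, Complex.ofReal_re, mul_comm]

variable [IsFiniteMeasure S.U]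

theorem integrable_contact (n : Fin S.N) (c d : TrigPoly S.N) :
    Integrable (fun z => starRingEnd ℂ (c.eval (S.contact n z)) * d.eval (S.contact n z))
      ((configMeasure S.N).prod S.U) := by
  have hc : Continuous fun z =>
      starRingEnd ℂ (c.eval (S.contact n z)) * d.eval (S.contact n z) :=
    (Complex.continuous_conj.comp (c.continuous_eval.comp (S.continuous_contact n))).mul
      (d.continuous_eval.comp (S.continuous_contact n))
  refine Integrable.of_bound hc.aestronglyMeasurable
    ((c.sum fun _ a => ‖a‖) * (d.sum fun _ a => ‖a‖)) (Eventually.of_forall fun z => ?_)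
  rw [norm_mul, RCLike.norm_conj]
  exact mul_le_mul (c.norm_eval_le _) (d.norm_eval_le _) (norm_nonneg _)
    (Finset.sum_nonneg fun _ _ => norm_nonneg _)

/-- Fubini for a bounded integrand and finite measures. The product form also allows the opposite
order of integration, needed for the Fermi sea. -/
theorem potentialForm_eq (c d : TrigPoly S.N) :
    S.potentialForm c d = ∑ n : Fin S.N, (S.L : ℂ)⁻¹ * S.contactForm n c d := by
  refine Finset.sum_congr rfl fun n _ => ?_
  rw [contactForm, integral_prod _ (S.integrable_contact n c d)]
  rfl

theorem potentialForm_add_left (c c' d : TrigPoly S.N) :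
    S.potentialForm (c + c') d = S.potentialForm c d + S.potentialForm c' d := by
  simp only [potentialForm_eq]
  rw [← Finset.sum_add_distrib]
  refine Finset.sum_congr rfl fun n _ => ?_
  rw [← mul_add, contactForm, contactForm, contactForm,
    ← integral_add (S.integrable_contact n c d) (S.integrable_contact n c' d)]
  simp only [TrigPoly.eval_add, map_add, add_mul]

theorem potentialForm_smul_left (a : ℂ) (c d : TrigPoly S.N) :
    S.potentialForm (a • c) d = starRingEnd ℂ a * S.potentialForm c d := by
  simp only [potentialForm_eq]
  rw [Finset.mul_sum]
  refine Finset.sum_congr rfl fun n _ => ?_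
  rw [mul_left_comm, contactForm, contactForm]
  simp only [TrigPoly.eval_smul, map_mul, mul_assoc, integral_const_mul]

theorem conj_potentialForm (c d : TrigPoly S.N) :
    starRingEnd ℂ (S.potentialForm d c) = S.potentialForm c d := by
  simp only [potentialForm_eq]
  rw [map_sum]
  refine Finset.sum_congr rfl fun n _ => ?_
  rw [map_mul, map_inv₀, Complex.conj_ofReal, contactForm, contactForm, ← integral_conj]
  simp only [map_mul, Complex.conj_conj, mul_comm]

/-- Repulsion enters here: on the diagonal the form is an integral of `|c|²` against a positive
measure. -/
theorem re_potentialForm_nonneg (hL : 0 < S.L) (c : TrigPoly S.N) :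
    0 ≤ (S.potentialForm c c).re := by
  rw [potentialForm_eq, Complex.re_sum]
  refine Finset.sum_nonneg fun n _ => ?_
  rw [← Complex.ofReal_inv, Complex.re_ofReal_mul]
  refine mul_nonneg (inv_nonneg.2 hL.le) ?_
  have h : S.contactForm n c c = ((∫ z, ‖c.eval (S.contact n z)‖ ^ 2
      ∂((configMeasure S.N).prod S.U) : ℝ) : ℂ) := by
    rw [contactForm, ← integral_complex_ofReal]
    refine integral_congr_ae (Eventually.of_forall fun z => ?_)
    dsimp only
    rw [mul_comm, Complex.mul_conj, Complex.normSq_eq_norm_sq]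
  rw [h, Complex.ofReal_re]
  exact integral_nonneg fun z => sq_nonneg _

theorem energyForm_add_left (c c' d : TrigPoly S.N) :
    S.energyForm (c + c') d = S.energyForm c d + S.energyForm c' d := by
  simp only [energyForm, potentialForm_add_left, Finsupp.sum, Finsupp.add_apply, map_add, add_mul,
    Finset.sum_add_distrib]
  ring

theorem energyForm_smul_left (a : ℂ) (c d : TrigPoly S.N) :
    S.energyForm (a • c) d = starRingEnd ℂ a * S.energyForm c d := by
  simp only [energyForm, potentialForm_smul_left, Finsupp.sum, Finsupp.smul_apply, smul_eq_mul,
    map_mul, mul_add, Finset.mul_sum, mul_assoc]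

theorem conj_energyForm (c d : TrigPoly S.N) :
    starRingEnd ℂ (S.energyForm d c) = S.energyForm c d := by
  classical
  rw [energyForm, energyForm, S.freeForm_eq d c (c.support ∪ d.support) Finset.subset_union_left,
    S.freeForm_eq c d (c.support ∪ d.support) Finset.subset_union_right, map_add,
    conj_potentialForm, map_sum]
  congr 1
  refine Finset.sum_congr rfl fun k _ => ?_
  rw [map_mul, map_mul, Complex.conj_conj, Complex.conj_ofReal]
  ring

end System

/-! ### Kinetic energy: the Fermi sea as host ground state, and growth with the momenta. -/

/-- Among all sets of `2M + 1` distinct integers, `{-M, …, M}` has the least sum of squares. -/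
theorem sum_sq_range_le_sum_sq {N : ℕ} (M : ℕ) (hN : N = 2 * M + 1) (f : Fin N → ℤ)
    (hf : Function.Injective f) :
    ∑ n : Fin N, ((n : ℤ) - M) ^ 2 ≤ ∑ n, f n ^ 2 := by
  classical
  have hg : Function.Injective fun n : Fin N => (n : ℤ) - M := fun a b h => by
    ext
    have : (a : ℤ) - M = b - M := h
    omega
  -- Both families have `N` members, so `M²` may be subtracted from each square. The function `k² -
  -- M²` is nonpositive on `{-M, …, M}` and nonnegative outside it, so replacing members of this set
  -- by outside integers cannot lower the sum.
  have key : ∑ n : Fin N, (((n : ℤ) - M) ^ 2 - M ^ 2) ≤ ∑ n, (f n ^ 2 - (M : ℤ) ^ 2) := by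
    have e1 : ∑ n : Fin N, (((n : ℤ) - M) ^ 2 - (M : ℤ) ^ 2)
        = ∑ k ∈ Finset.univ.image (fun n : Fin N => (n : ℤ) - M), (k ^ 2 - (M : ℤ) ^ 2) :=
      (Finset.sum_image (f := fun k : ℤ => k ^ 2 - (M : ℤ) ^ 2) fun a _ b _ h => hg h).symm
    have e2 : ∑ n, (f n ^ 2 - (M : ℤ) ^ 2)
        = ∑ k ∈ Finset.univ.image f, (k ^ 2 - (M : ℤ) ^ 2) :=
      (Finset.sum_image (f := fun k : ℤ => k ^ 2 - (M : ℤ) ^ 2) fun a _ b _ h => hf h).symm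
    rw [e1, e2]
    have hmem : ∀ k : ℤ, k ∈ Finset.univ.image (fun n : Fin N => (n : ℤ) - M) ↔
        -(M : ℤ) ≤ k ∧ k ≤ M := by
      intro k
      simp only [Finset.mem_image, Finset.mem_univ, true_and]
      constructor
      · rintro ⟨n, rfl⟩
        have := n.2
        omega
      · rintro ⟨h1, h2⟩
        refine ⟨⟨(k + M).toNat, by omega⟩, ?_⟩
        simp only
        omega
    set B := Finset.univ.image (fun n : Fin N => (n : ℤ) - M)
    set A := Finset.univ.image f
    calc ∑ k ∈ B, (k ^ 2 - (M : ℤ) ^ 2) ≤ ∑ k ∈ B ∩ A, (k ^ 2 - (M : ℤ) ^ 2) := by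
          rw [← Finset.sum_inter_add_sum_sdiff B A]
          have : ∑ k ∈ B \ A, (k ^ 2 - (M : ℤ) ^ 2) ≤ 0 := by
            refine Finset.sum_nonpos fun k hk => ?_
            have := (hmem k).1 (Finset.mem_sdiff.1 hk).1
            nlinarith
          linarith
      _ = ∑ k ∈ A ∩ B, (k ^ 2 - (M : ℤ) ^ 2) := by rw [Finset.inter_comm]
      _ ≤ ∑ k ∈ A, (k ^ 2 - (M : ℤ) ^ 2) := by
          rw [← Finset.sum_inter_add_sum_sdiff A B]
          have : 0 ≤ ∑ k ∈ A \ B, (k ^ 2 - (M : ℤ) ^ 2) := by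
            refine Finset.sum_nonneg fun k hk => ?_
            have h1 := mt (hmem k).2 (Finset.mem_sdiff.1 hk).2
            rw [not_and_or] at h1
            rcases h1 with h1 | h1 <;> nlinarith
          linarith
  simp only [Finset.sum_sub_distrib] at key
  linarith

theorem sum_sq_centered {N : ℕ} (M : ℕ) (hN : N = 2 * M + 1) :
    ∑ n : Fin N, (((n : ℕ) : ℝ) - M) ^ 2 = (N : ℝ) * (N + 1) * (N - 1) / 12 := by
  -- The induction is on the number of terms with the center `M` fixed; the relation `N = 2M + 1`
  -- enters only afterwards.
  have h : ∀ m : ℕ, ∑ n ∈ Finset.range m, ((n : ℝ) - M) ^ 2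
      = (m - 1) * m * (2 * m - 1) / 6 - M * (m * (m - 1)) + m * M ^ 2 := by
    intro m
    induction m with
    | zero => simp
    | succ m ih => rw [Finset.sum_range_succ, ih]; push_cast; ring
  rw [Fin.sum_univ_eq_sum_range (fun n => ((n : ℝ) - M) ^ 2) N, h, hN]
  push_cast
  ring

namespace System

variable (S : System)

theorem δk_pos (hL : 0 < S.L) : 0 < S.δk := by
  unfold δk
  positivity

/-- Together with `sum_sq_centered` this shows that `C` is precisely the kinetic energy of the
filled sea. -/
theorem C_eq (hN1 : 1 < S.N) (hmh : 0 < S.mh) :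
    S.C = S.δk ^ 2 / (2 * S.mh) * ((S.N : ℝ) * (S.N + 1) * (S.N - 1) / 12) := by
  have h : (S.N : ℝ) - 1 ≠ 0 := by
    have : (1 : ℝ) < S.N := by exact_mod_cast hN1
    linarith
  rw [C, kF, ← δk]
  field_simp
  ring

theorem C_nonneg (hN1 : 1 < S.N) (hmh : 0 < S.mh) : 0 ≤ S.C := by
  have : (1 : ℝ) < S.N := by exact_mod_cast hN1
  rw [S.C_eq hN1 hmh]
  have : (0 : ℝ) ≤ S.N - 1 := by linarith
  positivity

/-- On antisymmetric states the host kinetic energy is at least that of the Fermi sea. -/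
theorem impurity_energy_le_freeEnergy (hN : Odd S.N) (hN1 : 1 < S.N) (hmh : 0 < S.mh)
    {k : Mode S.N} (hk : Function.Injective fun n : Fin S.N => k (some n)) :
    (S.δk * k none) ^ 2 / (2 * S.mi) ≤ S.freeEnergy k := by
  obtain ⟨M, hM⟩ := hN
  have h1 := sum_sq_range_le_sum_sq M hM _ hk
  have h2 : ∑ n : Fin S.N, (((n : ℕ) : ℝ) - M) ^ 2 ≤ ∑ n, ((k (some n) : ℤ) : ℝ) ^ 2 := by
    exact_mod_cast h1
  rw [sum_sq_centered M hM] at h2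
  rw [freeEnergy, S.C_eq hN1 hmh]
  have h3 : ∑ n : Fin S.N, (S.δk * k (some n)) ^ 2 / (2 * S.mh)
      = S.δk ^ 2 / (2 * S.mh) * ∑ n, ((k (some n) : ℤ) : ℝ) ^ 2 := by
    rw [Finset.mul_sum]
    refine Finset.sum_congr rfl fun n _ => ?_
    ring
  rw [h3]
  have h4 := mul_le_mul_of_nonneg_left h2 (show 0 ≤ S.δk ^ 2 / (2 * S.mh) by positivity)
  linarith

theorem freeEnergy_seaMode (hN : Odd S.N) (hN1 : 1 < S.N) (hmh : 0 < S.mh) (n₀ : ℤ) :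
    S.freeEnergy (S.seaMode n₀) = (S.δk * n₀) ^ 2 / (2 * S.mi) := by
  obtain ⟨M, hM⟩ := hN
  have h1 : ((S.N : ℤ) - 1) / 2 = M := by omega
  rw [freeEnergy, S.C_eq hN1 hmh, ← sum_sq_centered M hM]
  simp only [seaMode, h1]
  rw [Finset.mul_sum, ← Finset.sum_sub_distrib, Finset.sum_eq_zero, zero_add]
  intro n _
  push_cast
  ring

theorem freeEnergy_relabel (σ : Equiv.Perm (Fin S.N)) (k : Mode S.N) :
    S.freeEnergy (relabel σ k) = S.freeEnergy k := by
  have h : ∑ n : Fin S.N, (S.δk * relabel σ k (some n)) ^ 2 / (2 * S.mh)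
      = ∑ n : Fin S.N, (S.δk * k (some n)) ^ 2 / (2 * S.mh) :=
    Equiv.sum_comp σ fun n => (S.δk * (k (some n) : ℤ)) ^ 2 / (2 * S.mh)
  rw [freeEnergy, freeEnergy, h]
  rfl

/-- The kinetic energy tends to infinity with the momenta. -/
theorem finite_freeEnergy_le (hL : 0 < S.L) (hmi : 0 < S.mi) (hmh : 0 < S.mh) (R : ℝ) :
    {k : Mode S.N | S.freeEnergy k ≤ R}.Finite := by
  have hδ := S.δk_pos hL
  -- Each kinetic term is at most `|R + C|`, so `(δk · k j)²` is at most twice the particle's mass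
  -- times `|R + C|`; adding the masses gives one bound for both species. Then `M > B + 1` ensures
  -- `B ≤ M²` without a square root.
  set B : ℝ := (2 * S.mi + 2 * S.mh) * |R + S.C| / S.δk ^ 2 with hB
  obtain ⟨M, hM⟩ := exists_nat_gt (B + 1)
  refine (Set.finite_Icc (fun _ => -(M : ℤ)) (fun _ => (M : ℤ))).subset fun k hk => ?_
  have hk1 : (∑ n : Fin S.N, (S.δk * k (some n)) ^ 2 / (2 * S.mh))
      + (S.δk * k none) ^ 2 / (2 * S.mi) ≤ |R + S.C| := by
    have : S.freeEnergy k ≤ R := hk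
    rw [freeEnergy] at this
    have := le_abs_self (R + S.C)
    linarith
  have habs := abs_nonneg (R + S.C)
  have hsum : 0 ≤ ∑ n : Fin S.N, (S.δk * k (some n)) ^ 2 / (2 * S.mh) :=
    Finset.sum_nonneg fun n _ => by positivity
  have hi : 0 ≤ (S.δk * k none) ^ 2 / (2 * S.mi) := by positivity
  have key : ∀ j, ((k j : ℤ) : ℝ) ^ 2 ≤ B := by
    intro j
    rw [hB, le_div_iff₀ (by positivity)]
    cases j with
    | none =>
      have h1 : (S.δk * k none) ^ 2 / (2 * S.mi) ≤ |R + S.C| := by linarith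
      rw [div_le_iff₀ (by positivity)] at h1
      nlinarith [mul_nonneg habs hmh.le]
    | some n =>
      have h2 := Finset.single_le_sum
        (f := fun n : Fin S.N => (S.δk * k (some n)) ^ 2 / (2 * S.mh))
        (fun n _ => by positivity) (Finset.mem_univ n)
      have h1 : (S.δk * k (some n)) ^ 2 / (2 * S.mh) ≤ |R + S.C| := by
        linarith
      rw [div_le_iff₀ (by positivity)] at h1
      nlinarith [mul_nonneg habs hmi.le]
  have hbd : ∀ j, |k j| ≤ (M : ℤ) := by
    intro j
    have h1 := key j
    have h2 : |((k j : ℤ) : ℝ)| ≤ M := by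
      refine abs_le_of_sq_le_sq ?_ (by positivity)
      have h3 : (0 : ℝ) ≤ B := by positivity
      nlinarith
    exact_mod_cast h2
  exact ⟨fun j => (abs_le.1 (hbd j)).1, fun j => (abs_le.1 (hbd j)).2⟩

end System

/-! ### Extension by density and finite-rank momentum cutoffs. -/

theorem exists_continuous_extension {V Q E : Type*} [AddCommGroup V] [Module ℂ V]
    [NormedAddCommGroup Q] [NormedSpace ℂ Q] [NormedAddCommGroup E] [NormedSpace ℂ E]
    [CompleteSpace E] {j : V →ₗ[ℂ] Q} (hj : DenseRange j) (f : V →ₗ[ℂ] E)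
    (hf : ∃ M, ∀ x, ‖f x‖ ≤ M * ‖j x‖) : ∃ A : Q →L[ℂ] E, ∀ x, A (j x) = f x :=
  ⟨f.extendOfNorm j, LinearMap.extendOfNorm_eq hj hf⟩

/-- The projection on finitely many plane waves. -/
def modeProjection {N : ℕ} (s : Finset (Mode N)) : WaveSpace N →L[ℂ] WaveSpace N :=
  ∑ k ∈ s, (ContinuousLinearMap.toSpanSingleton ℂ (planeWave k)).comp (innerSL ℂ (planeWave k))

theorem modeProjection_apply {N : ℕ} (s : Finset (Mode N)) (ψ : WaveSpace N) :
    modeProjection s ψ = ∑ k ∈ s, amplitude ψ k • planeWave k := by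
  rw [modeProjection, _root_.sum_apply]
  rfl

theorem isCompactOperator_modeProjection {N : ℕ} (s : Finset (Mode N)) :
    IsCompactOperator (modeProjection s) := by
  classical
  have : ∀ s : Finset (Mode N), modeProjection s
      ∈ compactOperator (RingHom.id ℂ) (WaveSpace N) (WaveSpace N) := fun s =>
    Submodule.sum_mem _ fun k _ =>
      (isCompactOperator_of_locallyCompactSpace_dom (innerSL ℂ (planeWave k))).clm_comp
        (ContinuousLinearMap.toSpanSingleton ℂ (planeWave k))
  exact this s

theorem toWave_sub_modeProjection {N : ℕ} (s : Finset (Mode N)) [DecidablePred (· ∉ s)]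
    (c : TrigPoly N) :
    c.toWave - modeProjection s c.toWave = TrigPoly.toWave (c.filter (· ∉ s)) := by
  classical
  refine amplitude_ext fun l => ?_
  rw [amplitude_toWave, modeProjection_apply, amplitude, inner_sub_right, inner_sum]
  simp only [inner_smul_right, inner_planeWave, amplitude_toWave, mul_ite, mul_one, mul_zero,
    Finset.sum_ite_eq, Finsupp.filter_apply]
  change amplitude c.toWave l - _ = _
  rw [amplitude_toWave]
  split_ifs <;> simp_all

/-- Multiplication of the amplitudes by a function of the modes. -/
def weightedWave {N : ℕ} (w : Mode N → ℂ) : TrigPoly N →ₗ[ℂ] WaveSpace N :=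
  Finsupp.linearCombination ℂ fun k => w k • planeWave k

theorem amplitude_weightedWave {N : ℕ} (w : Mode N → ℂ) (c : TrigPoly N) (k : Mode N) :
    amplitude (weightedWave w c) k = w k * c k := by
  classical
  rw [weightedWave, Finsupp.linearCombination_apply, amplitude, Finsupp.sum, inner_sum]
  simp only [inner_smul_right, inner_planeWave, mul_ite, mul_one, mul_zero, Finset.sum_ite_eq,
    Finsupp.mem_support_iff]
  split_ifs with h
  · ring
  · rw [not_not.1 h, mul_zero]

theorem norm_weightedWave_sq {N : ℕ} (w : Mode N → ℂ) (c : TrigPoly N) :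
    ‖weightedWave w c‖ ^ 2 = c.sum fun k a => ‖w k‖ ^ 2 * ‖a‖ ^ 2 := by
  refine (hasSum_norm_amplitude_sq (weightedWave w c)).unique ?_
  simp only [amplitude_weightedWave, norm_mul, mul_pow]
  refine hasSum_sum_of_ne_finset_zero fun k hk => ?_
  rw [Finsupp.notMem_support_iff.1 hk]
  simp

/-! ### The form domain, the Friedrichs operator and compactness. -/

namespace System

variable (S : System)

/-- `Q` is the completion of the antisymmetric trigonometric polynomials in the norm of the
shifted energy form, `j` is the canonical map, and `G` is the continuous extension of the
inclusion into the Hilbert space. -/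
structure IsFormEmbedding {Q : Type*} [NormedAddCommGroup Q] [InnerProductSpace ℂ Q]
    (j : AntisymmPoly S.N →ₗ[ℂ] Q) (G : Q →L[ℂ] fermionSpace S.N) : Prop where
  dense : DenseRange j
  inner_map : ∀ c d, inner ℂ (j c) (j d) = S.energyForm c d
    + ((1 + S.C : ℝ) : ℂ) * inner ℂ (c : TrigPoly S.N).toWave (d : TrigPoly S.N).toWave
  map_apply : ∀ c, G (j c) = toFermion S.N c

section Embedding

variable {S} {Q : Type*} [NormedAddCommGroup Q] [InnerProductSpace ℂ Q]
  {j : AntisymmPoly S.N →ₗ[ℂ] Q} {G : Q →L[ℂ] fermionSpace S.N}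

theorem IsFormEmbedding.norm_sq (h : S.IsFormEmbedding j G)
    (c : AntisymmPoly S.N) :
    ‖j c‖ ^ 2 = (S.energyForm c c).re + (1 + S.C) * ‖(c : TrigPoly S.N).toWave‖ ^ 2 := by
  have h1 := h.inner_map c c
  rw [inner_self_eq_norm_sq_to_K, inner_self_eq_norm_sq_to_K] at h1
  have h2 := congrArg Complex.re h1
  rw [Complex.add_re, Complex.re_ofReal_mul] at h2
  norm_cast at h2

variable [CompleteSpace Q]

/-- The Friedrichs operator in terms of the embedding of the form domain: `H + λ` is the inverse
of `G G†`. -/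
theorem IsFormEmbedding.isHamiltonian_iff (hjG : S.IsFormEmbedding j G) (ψ η : fermionSpace S.N) :
    S.IsHamiltonian ψ η ↔ ψ = G (G.adjoint (η + ((1 + S.C : ℝ) : ℂ) • ψ)) := by
  constructor
  · rintro ⟨c, hc, hlim, hcau, hrep⟩
    let u : ℕ → AntisymmPoly S.N := fun n => ⟨c n, hc n⟩
    -- Being Cauchy for the form and in `L²` together means being Cauchy in `Q`.
    have hsq : Tendsto (fun n : ℕ × ℕ => dist (j (u n.1)) (j (u n.2)) ^ 2) atTop (𝓝 0) := by
      have h1 : ∀ n : ℕ × ℕ, dist (j (u n.1)) (j (u n.2)) ^ 2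
          = (S.energyForm (c n.1 - c n.2) (c n.1 - c n.2)).re
            + (1 + S.C) * dist (c n.1).toWave (c n.2).toWave ^ 2 := by
        intro n
        have h2 : (c n.1).toWave - (c n.2).toWave = (c n.1 - c n.2 : TrigPoly S.N).toWave :=
          ((toWaveₗ S.N).map_sub _ _).symm
        rw [dist_eq_norm, ← map_sub, hjG.norm_sq, dist_eq_norm, h2]
        rfl
      simp only [h1]
      have h2 := cauchySeq_iff_tendsto_dist_atTop_0.1 hlim.cauchySeq
      have h3 := ((Complex.continuous_re.tendsto 0).comp hcau).add ((h2.pow 2).const_mul (1 + S.C))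
      simpa using h3
    have hcs : CauchySeq fun n => j (u n) := by
      rw [cauchySeq_iff_tendsto_dist_atTop_0]
      have := hsq.sqrt
      simpa only [Real.sqrt_sq dist_nonneg, Real.sqrt_zero] using this
    obtain ⟨f, hf⟩ := cauchySeq_tendsto_of_complete hcs
    have hψ : ψ = G f := by
      have h1 : Tendsto (fun n => (G (j (u n)) : WaveSpace S.N)) atTop
          (𝓝 (G f : WaveSpace S.N)) :=
        (continuous_subtype_val.tendsto _).comp ((G.continuous.tendsto _).comp hf)
      simp only [hjG.map_apply, coe_toFermion] at h1
      exact Subtype.ext (tendsto_nhds_unique hlim h1)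
    -- The weak equation for `η`, shifted by `(1 + C) ψ`, determines the inner products of `f` with
    -- the dense vectors `j d`; the definition of the adjoint then identifies `f`.
    have hfeq : f = G.adjoint (η + ((1 + S.C : ℝ) : ℂ) • ψ) := by
      refine ext_inner_left ℂ fun v => ?_
      refine hjG.dense.induction_on (p := fun v => inner ℂ v f
        = inner ℂ v (G.adjoint (η + ((1 + S.C : ℝ) : ℂ) • ψ))) v
        (isClosed_eq (by fun_prop) (by fun_prop)) fun d => ?_
      have h1 : Tendsto (fun n => inner ℂ (j d) (j (u n))) atTop (𝓝 (inner ℂ (j d) f)) :=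
        tendsto_const_nhds.inner hf
      have h2 : Tendsto (fun n => inner ℂ (j d) (j (u n))) atTop
          (𝓝 (inner ℂ (d : TrigPoly S.N).toWave (η : WaveSpace S.N)
            + ((1 + S.C : ℝ) : ℂ)
              * inner ℂ (d : TrigPoly S.N).toWave (ψ : WaveSpace S.N))) := by
        simp only [hjG.inner_map]
        exact (hrep d d.isAntisymm).add ((tendsto_const_nhds.inner hlim).const_mul _)
      rw [tendsto_nhds_unique h1 h2, ContinuousLinearMap.adjoint_inner_right, hjG.map_apply, Submodule.coe_inner,
        coe_toFermion, Submodule.coe_add, Submodule.coe_smul, inner_add_right, inner_smul_right]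
    rw [← hfeq]
    exact hψ
  · intro h
    -- Conversely, any polynomials approximating this `f` in `Q` form an admissible sequence for
    -- `IsHamiltonian`.
    set f := G.adjoint (η + ((1 + S.C : ℝ) : ℂ) • ψ) with hf
    obtain ⟨v, hv, hvf⟩ := mem_closure_iff_seq_limit.1 (hjG.dense f)
    choose u hu using hv
    have huf : Tendsto (fun n => j (u n)) atTop (𝓝 f) := by simpa only [hu] using hvf
    have hwave : Tendsto (fun n => (u n : TrigPoly S.N).toWave) atTop (𝓝 (ψ : WaveSpace S.N)) := by
      have h1 : Tendsto (fun n => (G (j (u n)) : WaveSpace S.N)) atTop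
          (𝓝 (G f : WaveSpace S.N)) :=
        (continuous_subtype_val.tendsto _).comp ((G.continuous.tendsto _).comp huf)
      simpa only [hjG.map_apply, coe_toFermion, ← h] using h1
    refine ⟨fun n => u n, fun n => (u n).isAntisymm, hwave, ?_, fun d hd => ?_⟩
    · have h1 : ∀ n : ℕ × ℕ, S.energyForm ((u n.1 : TrigPoly S.N) - u n.2) (u n.1 - u n.2)
          = inner ℂ (j (u n.1) - j (u n.2)) (j (u n.1) - j (u n.2))
            - ((1 + S.C : ℝ) : ℂ) * inner ℂ
              ((u n.1 : TrigPoly S.N).toWave - (u n.2 : TrigPoly S.N).toWave)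
              ((u n.1 : TrigPoly S.N).toWave - (u n.2 : TrigPoly S.N).toWave) := by
        intro n
        rw [← map_sub j, hjG.inner_map, ← toWaveₗ_apply, ← toWaveₗ_apply, ← toWaveₗ_apply,
          map_sub (AntisymmPoly.toPoly S.N), map_sub (toWaveₗ S.N)]
        ring
      simp only [h1]
      rw [← prod_atTop_atTop_eq]
      have h2 : Tendsto (fun n : ℕ × ℕ => j (u n.1) - j (u n.2)) (atTop ×ˢ atTop) (𝓝 (f - f)) :=
        (huf.comp tendsto_fst).sub (huf.comp tendsto_snd)
      have h3 : Tendsto (fun n : ℕ × ℕ => (u n.1 : TrigPoly S.N).toWave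
          - (u n.2 : TrigPoly S.N).toWave) (atTop ×ˢ atTop)
          (𝓝 ((ψ : WaveSpace S.N) - (ψ : WaveSpace S.N))) :=
        (hwave.comp tendsto_fst).sub (hwave.comp tendsto_snd)
      have h4 := (h2.inner (𝕜 := ℂ) h2).sub ((h3.inner (𝕜 := ℂ) h3).const_mul ((1 + S.C : ℝ) : ℂ))
      simpa only [sub_self, inner_zero_right, mul_zero] using h4
    · obtain ⟨d, rfl⟩ := hd.exists_eq
      have h1 : ∀ n, S.energyForm d (u n) = inner ℂ (j d) (j (u n))
          - ((1 + S.C : ℝ) : ℂ) * inner ℂ (d : TrigPoly S.N).toWave (u n : TrigPoly S.N).toWave := by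
        intro n
        rw [hjG.inner_map]
        ring
      simp only [h1]
      have h2 : Tendsto (fun n => inner ℂ (j d) (j (u n))
          - ((1 + S.C : ℝ) : ℂ) * inner ℂ (d : TrigPoly S.N).toWave (u n : TrigPoly S.N).toWave) atTop
          (𝓝 (inner ℂ (j d) f
            - ((1 + S.C : ℝ) : ℂ) * inner ℂ (d : TrigPoly S.N).toWave (ψ : WaveSpace S.N))) :=
        (tendsto_const_nhds.inner huf).sub ((tendsto_const_nhds.inner hwave).const_mul _)
      convert h2 using 2
      rw [hf, ContinuousLinearMap.adjoint_inner_right, hjG.map_apply, Submodule.coe_inner,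
        coe_toFermion, Submodule.coe_add, Submodule.coe_smul, inner_add_right, inner_smul_right]
      ring

/-- The range of `G` contains all antisymmetric polynomials. Consequently `0` is not an eigenvalue
of `G G†`, which gives meaning to its inverse. -/
theorem IsFormEmbedding.eq_zero_of_adjoint_eq_zero (hjG : S.IsFormEmbedding j G) {ψ : fermionSpace S.N}
    (h : G.adjoint ψ = 0) : ψ = 0 := by
  refine eq_zero_of_inner_toWave_eq_zero ψ fun c hc => ?_
  obtain ⟨c, rfl⟩ := hc.exists_eq
  have h1 : inner ℂ (j c) (G.adjoint ψ) = 0 := by rw [h, inner_zero_right]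
  rwa [ContinuousLinearMap.adjoint_inner_right, hjG.map_apply, Submodule.coe_inner, coe_toFermion] at h1

end Embedding

section FormDomain

variable [IsFiniteMeasure S.U]

/-- The central inequality `p_i² / (2 m_i) ≤ H`. Antisymmetry leaves only modes with distinct
fermion momenta, where the host energy above the sea is nonnegative; the interaction is dropped by
positivity. -/
theorem re_energyForm_ge (hN : Odd S.N) (hN1 : 1 < S.N) (hL : 0 < S.L) (hmh : 0 < S.mh)
    {c : TrigPoly S.N} (hc : c.IsAntisymm) :
    (c.sum fun k a => (S.δk * k none) ^ 2 / (2 * S.mi) * ‖a‖ ^ 2) ≤ (S.energyForm c c).re := by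
  rw [re_energyForm_self]
  refine le_add_of_le_of_nonneg (Finset.sum_le_sum fun k hk => ?_) (S.re_potentialForm_nonneg hL c)
  exact mul_le_mul_of_nonneg_right (S.impurity_energy_le_freeEnergy hN hN1 hmh
    (hc.injective (Finsupp.mem_support_iff.1 hk))) (sq_nonneg _)

theorem re_energyForm_nonneg (hN : Odd S.N) (hN1 : 1 < S.N) (hL : 0 < S.L) (hmi : 0 < S.mi)
    (hmh : 0 < S.mh) {c : TrigPoly S.N} (hc : c.IsAntisymm) : 0 ≤ (S.energyForm c c).re :=
  (Finset.sum_nonneg fun k _ => by positivity).trans (S.re_energyForm_ge hN hN1 hL hmh hc)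

/-- The energy form, shifted to be strictly positive, on antisymmetric trigonometric
polynomials. -/
@[reducible]
def formCore (hN : Odd S.N) (hN1 : 1 < S.N) (hL : 0 < S.L) (hmi : 0 < S.mi) (hmh : 0 < S.mh) :
    PreInnerProductSpace.Core ℂ (AntisymmPoly S.N) where
  inner c d := S.energyForm c d
    + ((1 + S.C : ℝ) : ℂ) * inner ℂ (c : TrigPoly S.N).toWave (d : TrigPoly S.N).toWave
  conj_inner_symm c d := by
    rw [map_add, conj_energyForm, map_mul, Complex.conj_ofReal, inner_conj_symm]
  re_inner_nonneg c := by
    have h1 := S.re_energyForm_nonneg hN hN1 hL hmi hmh c.isAntisymm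
    have h2 := S.C_nonneg hN1 hmh
    rw [inner_self_eq_norm_sq_to_K]
    simp only [map_add, RCLike.re_to_complex, Complex.re_ofReal_mul]
    norm_cast
    exact add_nonneg h1 (mul_nonneg (by linarith) (sq_nonneg ‖(c : TrigPoly S.N).toWave‖))
  add_left c c' d := by
    rw [map_add, energyForm_add_left, ← toWaveₗ_apply, ← toWaveₗ_apply, map_add,
      inner_add_left]
    simp only [toWaveₗ_apply]
    ring
  smul_left c d a := by
    rw [map_smul, energyForm_smul_left, ← toWaveₗ_apply, ← toWaveₗ_apply, map_smul,
      inner_smul_left]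
    simp only [toWaveₗ_apply]
    ring

variable {S} {Q : Type*} [NormedAddCommGroup Q] [InnerProductSpace ℂ Q]
  {j : AntisymmPoly S.N →ₗ[ℂ] Q} {G : Q →L[ℂ] fermionSpace S.N}

/-- A Rellich argument: modes of high kinetic energy carry little of the `L²` norm relative to the
form norm, and finitely many modes remain. Thus `G` is a norm limit of finite-rank operators. -/
theorem IsFormEmbedding.isCompactOperator (hN1 : 1 < S.N) (hL : 0 < S.L)
    (hmi : 0 < S.mi) (hmh : 0 < S.mh) (hjG : S.IsFormEmbedding j G) : IsCompactOperator G := by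
  classical
  let ι : fermionSpace S.N →L[ℂ] WaveSpace S.N := (fermionSpace S.N).subtypeL
  let A : Q →L[ℂ] WaveSpace S.N := ι.comp G
  let s : ℕ → Finset (Mode S.N) := fun R =>
    (S.finite_freeEnergy_le hL hmi hmh (R : ℝ)).toFinset
  have hC := S.C_nonneg hN1 hmh
  -- The shift contains `C` so that the weight of each single mode is nonnegative, without using
  -- antisymmetry.
  have hw : ∀ k : Mode S.N, 0 ≤ S.C + S.freeEnergy k := fun k => by
    have h1 : 0 ≤ ∑ n : Fin S.N, (S.δk * k (some n)) ^ 2 / (2 * S.mh) :=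
      Finset.sum_nonneg fun n _ => by positivity
    have h2 : 0 ≤ (S.δk * k none) ^ 2 / (2 * S.mi) := by positivity
    rw [freeEnergy]
    linarith
  -- A mode outside `s R` has free energy above `R`, so its weight in the shifted form exceeds `R +
  -- 1`.
  have hbound : ∀ (R : ℕ) f, (R + 1 : ℝ) * ‖A f - modeProjection (s R) (A f)‖ ^ 2 ≤ ‖f‖ ^ 2 := by
    intro R f
    refine hjG.dense.induction_on (p := fun f =>
      (R + 1 : ℝ) * ‖A f - modeProjection (s R) (A f)‖ ^ 2 ≤ ‖f‖ ^ 2) f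
      (isClosed_le (by fun_prop) (by fun_prop)) fun c => ?_
    have hA : A (j c) = (c : TrigPoly S.N).toWave := by
      change ((G (j c) : fermionSpace S.N) : WaveSpace S.N) = _
      rw [hjG.map_apply, coe_toFermion]
    rw [hA, toWave_sub_modeProjection, hjG.norm_sq, re_energyForm_self, norm_toWave_sq,
      norm_toWave_sq, Finsupp.sum, Finsupp.sum, Finsupp.sum, Finsupp.support_filter,
      Finset.mul_sum, Finset.mul_sum, add_right_comm, ← Finset.sum_add_distrib]
    refine le_add_of_le_of_nonneg ?_ (S.re_potentialForm_nonneg hL _)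
    rw [Finset.sum_filter]
    refine Finset.sum_le_sum fun k _ => ?_
    have h3 := sq_nonneg ‖(c : TrigPoly S.N) k‖
    split_ifs with hk
    · rw [← add_mul]
      exact mul_nonneg (by linarith [hw k]) h3
    · rw [Finsupp.filter_apply_pos (· ∉ s R) _ hk, ← add_mul]
      refine mul_le_mul_of_nonneg_right ?_ h3
      have : ¬ S.freeEnergy k ≤ R := by simpa [s] using hk
      linarith
  have hA : IsCompactOperator A := by
    have hlim : Tendsto (fun R : ℕ => (modeProjection (s R)).comp A) atTop (𝓝 A) := by
      rw [tendsto_iff_norm_sub_tendsto_zero]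
      have h0 : Tendsto (fun R : ℕ => Real.sqrt (1 / ((R : ℝ) + 1))) atTop (𝓝 0) := by
        have := (tendsto_one_div_add_atTop_nhds_zero_nat (𝕜 := ℝ)).sqrt
        simpa using this
      refine squeeze_zero (fun R => norm_nonneg _) (fun R => ?_) h0
      refine ContinuousLinearMap.opNorm_le_bound _ (Real.sqrt_nonneg _) fun f => ?_
      rw [_root_.sub_apply, norm_sub_rev, ContinuousLinearMap.comp_apply]
      refine Real.le_sqrt_of_sq_le ?_ |>.trans_eq
        (show Real.sqrt (1 / ((R : ℝ) + 1) * ‖f‖ ^ 2) = _ from ?_)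
      · have := hbound R f
        rw [one_div, ← div_eq_inv_mul, le_div_iff₀ (by positivity)]
        rw [mul_comm]
        exact this
      · rw [Real.sqrt_mul (by positivity), Real.sqrt_sq (norm_nonneg _)]
    exact isCompactOperator_of_tendsto hlim (Eventually.of_forall fun R =>
      (isCompactOperator_modeProjection (s R)).comp_clm A)
  have h := hA.codRestrict (V := fermionSpace S.N) (fun f => (G f).2) (isClosed_fermionSpace S.N)
  exact h

/-- The impurity momentum on the form domain. -/
theorem IsFormEmbedding.exists_momentum_operator (hN : Odd S.N) (hN1 : 1 < S.N) (hL : 0 < S.L)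
    (hmi : 0 < S.mi) (hmh : 0 < S.mh) (hjG : S.IsFormEmbedding j G) :
    ∃ A : Q →L[ℂ] WaveSpace S.N,
      (∀ f k, amplitude (A f) k
        = ((S.δk * k none : ℝ) : ℂ) * amplitude (G f : WaveSpace S.N) k) ∧
      ∀ f, ‖A f‖ ^ 2 ≤ 2 * S.mi * (‖f‖ ^ 2 - (1 + S.C) * ‖G f‖ ^ 2) := by
  classical
  obtain ⟨p, hpc⟩ : ∃ p : AntisymmPoly S.N →ₗ[ℂ] WaveSpace S.N, ∀ c,
      p c = weightedWave (fun k : Mode S.N => ((S.δk * k none : ℝ) : ℂ)) c :=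
    ⟨(weightedWave fun k : Mode S.N => ((S.δk * k none : ℝ) : ℂ)).comp
      (AntisymmPoly.toPoly S.N), fun c => rfl⟩
  have hp : ∀ (c : AntisymmPoly S.N) k,
      amplitude (p c) k = ((S.δk * k none : ℝ) : ℂ) * (c : TrigPoly S.N) k := fun c k => by
    rw [hpc, amplitude_weightedWave]
  have hpn : ∀ c : AntisymmPoly S.N, ‖p c‖ ^ 2 ≤ 2 * S.mi * (S.energyForm c c).re := by
    intro c
    have h1 : ‖p c‖ ^ 2 = (c : TrigPoly S.N).sum fun k a => (S.δk * k none) ^ 2 * ‖a‖ ^ 2 := by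
      rw [hpc, norm_weightedWave_sq]
      simp only [Complex.norm_real, Real.norm_eq_abs, sq_abs]
    have h2 := mul_le_mul_of_nonneg_left (S.re_energyForm_ge hN hN1 hL hmh c.isAntisymm)
      (show 0 ≤ 2 * S.mi by positivity)
    refine le_trans (le_of_eq ?_) h2
    rw [h1, Finsupp.sum, Finsupp.sum, Finset.mul_sum]
    refine Finset.sum_congr rfl fun k _ => ?_
    rw [← mul_assoc, mul_div_cancel₀ _ (by positivity)]
  have hC := S.C_nonneg hN1 hmh
  have hnorm : ∃ M, ∀ c, ‖p c‖ ≤ M * ‖j c‖ := by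
    refine ⟨Real.sqrt (2 * S.mi), fun c => ?_⟩
    rw [← Real.sqrt_sq (norm_nonneg (j c)), ← Real.sqrt_mul (by positivity)]
    refine Real.le_sqrt_of_sq_le ((hpn c).trans ?_)
    rw [hjG.norm_sq]
    exact mul_le_mul_of_nonneg_left (le_add_of_nonneg_right (by positivity)) (by positivity)
  obtain ⟨A, hA⟩ : ∃ A : Q →L[ℂ] WaveSpace S.N, ∀ c, A (j c) = p c :=
    exists_continuous_extension hjG.dense p hnorm
  refine ⟨A, fun f k => ?_, fun f => ?_⟩
  · refine hjG.dense.induction_on (p := fun f => amplitude (A f) k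
      = ((S.δk * k none : ℝ) : ℂ) * amplitude (G f : WaveSpace S.N) k) f
      (isClosed_eq ((continuous_amplitude k).comp A.continuous)
        (((continuous_amplitude k).comp
          (continuous_subtype_val.comp G.continuous)).const_mul _)) fun c => ?_
    rw [hA, hp, hjG.map_apply, coe_toFermion, amplitude_toWave]
  -- On polynomials the bracket is the energy, so the claim reduces to `hpn`; both sides are
  -- continuous on `Q`.
  · refine hjG.dense.induction_on (p := fun f => ‖A f‖ ^ 2
      ≤ 2 * S.mi * (‖f‖ ^ 2 - (1 + S.C) * ‖G f‖ ^ 2)) f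
      (isClosed_le (by fun_prop) (by fun_prop)) fun c => ?_
    rw [hA, hjG.map_apply, hjG.norm_sq, Submodule.coe_norm, coe_toFermion, add_sub_cancel_right]
    exact hpn c

end FormDomain

end System

/-! ### The energy of the initial state and the existence of the form domain. -/

section Contract

variable {N : ℕ}

/-- The momenta after the momentum of the `n`-th fermion is transferred to the impurity. -/
def contract (n : Fin N) (k : Mode N) : Mode N
  | none => k none + k (some n)
  | some m => if m = n then 0 else k (some m)

/-- On the slice `xₙ = xᵢ + y` the momentum `kₙ` passes to the impurity and leaves a phase in `y`;
the entry `0` in `contract` expresses that `xₙ` has disappeared. -/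
theorem mFourier_update (n : Fin N) (k : Mode N) (x : Config N) (y : UnitAddCircle) :
    UnitAddTorus.mFourier k (Function.update x (some n) (x none + y))
      = fourier (k (some n)) y * UnitAddTorus.mFourier (contract n k) x := by
  simp only [UnitAddTorus.mFourier, ContinuousMap.coe_mk, Fintype.prod_option]
  rw [← Finset.mul_prod_erase _ _ (Finset.mem_univ n),
    ← Finset.mul_prod_erase _ (fun m => fourier (contract n k (some m)) (x (some m)))
      (Finset.mem_univ n)]
  have h1 : ∏ m ∈ Finset.univ.erase n,
      (fourier (k (some m)) (Function.update x (some n) (x none + y) (some m)) : ℂ)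
      = ∏ m ∈ Finset.univ.erase n, fourier (contract n k (some m)) (x (some m)) := by
    refine Finset.prod_congr rfl fun m hm => ?_
    have hmn : m ≠ n := Finset.ne_of_mem_erase hm
    rw [Function.update_of_ne (by simpa using hmn)]
    simp [contract, hmn]
  have h2 : (fourier (k (some n)) (x none + y) : ℂ)
      = fourier (k (some n)) (x none) * fourier (k (some n)) y := by
    simp only [fourier_apply, smul_add, AddCircle.toCircle_add, Circle.coe_mul]
  rw [h1, Function.update_self, Function.update_of_ne (by simp), h2]
  simp only [contract, if_true, fourier_zero, one_mul, fourier_add]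
  ring

theorem perm_eq_of_eq_off {α : Type*} {σ τ : Equiv.Perm α} (a : α)
    (h : ∀ b, b ≠ a → σ b = τ b) : σ = τ := by
  have ha : σ a = τ a := by
    by_contra hne
    have hb : τ.symm (σ a) ≠ a := fun hb => hne ((τ.symm_apply_eq).1 hb)
    have h1 := h _ hb
    rw [Equiv.apply_symm_apply] at h1
    exact hb (σ.injective h1)
  ext b
  by_cases hb : b = a
  · rw [hb, ha]
  · exact h b hb

end Contract

namespace System

variable (S : System)

theorem seaMode_some_injective (n₀ : ℤ) :
    Function.Injective fun n : Fin S.N => S.seaMode n₀ (some n) := fun a b h => by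
  have : (a : ℤ) - ((S.N : ℤ) - 1) / 2 = b - ((S.N : ℤ) - 1) / 2 := h
  ext
  omega

theorem relabel_seaMode_injective (n₀ : ℤ) :
    Function.Injective fun σ : Equiv.Perm (Fin S.N) => relabel σ (S.seaMode n₀) := by
  intro σ τ h
  ext n : 1
  exact S.seaMode_some_injective n₀ (congrFun h (some n))

/-- The momenta of the other fermions already determine the permutation. The contracted plane waves
of the Slater determinant therefore remain orthonormal, and the contact density has no interference
terms. -/
theorem contract_relabel_seaMode_injective (n₀ : ℤ) (n : Fin S.N) :
    Function.Injective fun σ : Equiv.Perm (Fin S.N) =>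
      contract n (relabel σ (S.seaMode n₀)) := by
  intro σ τ h
  refine perm_eq_of_eq_off n fun m hm => ?_
  have h1 := congrFun h (some m)
  simp only [contract, if_neg hm] at h1
  exact S.seaMode_some_injective n₀ h1

theorem orthonormal_planeWave_comp {N : ℕ} {ι : Type*} {f : ι → Mode N}
    (hf : Function.Injective f) : Orthonormal ℂ fun i => planeWave (f i) := by
  have := (planeWaveBasis N).orthonormal.comp f hf
  simpa only [Function.comp_def, planeWaveBasis_apply] using this

theorem inner_sum_planeWave_self {N : ℕ} {ι : Type*} [Fintype ι] {f : ι → Mode N}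
    (hf : Function.Injective f) (a : ι → ℂ) :
    inner ℂ (∑ i, a i • planeWave (f i)) (∑ i, a i • planeWave (f i))
      = ((∑ i, ‖a i‖ ^ 2 : ℝ) : ℂ) := by
  rw [(orthonormal_planeWave_comp hf).inner_sum a a Finset.univ]
  push_cast
  refine Finset.sum_congr rfl fun i _ => ?_
  rw [mul_comm, Complex.mul_conj, Complex.normSq_eq_norm_sq, Complex.ofReal_pow]

/-- The amplitude of a permutation in the Slater determinant. -/
def slaterCoeff {N : ℕ} (σ : Equiv.Perm (Fin N)) : ℂ :=
  csign σ * ((Real.sqrt (N.factorial) : ℝ) : ℂ)⁻¹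

theorem sum_norm_slaterCoeff_sq (N : ℕ) :
    ∑ σ : Equiv.Perm (Fin N), ‖slaterCoeff σ‖ ^ 2 = 1 := by
  have h : ∀ σ : Equiv.Perm (Fin N), ‖slaterCoeff σ‖ ^ 2 = ((N.factorial : ℝ))⁻¹ := by
    intro σ
    have h1 : ‖csign σ‖ = 1 := by
      rcases Int.units_eq_one_or (Equiv.Perm.sign σ) with h | h <;> simp [csign, h]
    rw [slaterCoeff, norm_mul, h1, one_mul, norm_inv, Complex.norm_real,
      Real.norm_of_nonneg (Real.sqrt_nonneg _), inv_pow, Real.sq_sqrt (by positivity)]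
  simp only [h, Finset.sum_const, Finset.card_univ, Fintype.card_perm, Fintype.card_fin,
    nsmul_eq_mul]
  exact mul_inv_cancel₀ (by exact_mod_cast N.factorial_ne_zero)

theorem toWave_seaCoeff (n₀ : ℤ) : (S.seaCoeff n₀).toWave
    = ∑ σ, slaterCoeff σ • planeWave (relabel σ (S.seaMode n₀)) := by
  rw [← toWaveₗ_apply, seaCoeff, map_sum]
  refine Finset.sum_congr rfl fun σ _ => ?_
  rw [toWaveₗ, Finsupp.linearCombination_single]
  rfl

theorem inner_seaCoeff_self (n₀ : ℤ) :
    inner ℂ (S.seaCoeff n₀).toWave (S.seaCoeff n₀).toWave = 1 := by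
  rw [toWave_seaCoeff, inner_sum_planeWave_self (S.relabel_seaMode_injective n₀),
    sum_norm_slaterCoeff_sq, Complex.ofReal_one]

theorem norm_toWave_seaCoeff (n₀ : ℤ) : ‖(S.seaCoeff n₀).toWave‖ = 1 := by
  rw [@norm_eq_sqrt_re_inner ℂ, inner_seaCoeff_self]
  simp

theorem eval_seaCoeff (n₀ : ℤ) (x : Config S.N) : (S.seaCoeff n₀).eval x
    = ∑ σ, slaterCoeff σ * UnitAddTorus.mFourier (relabel σ (S.seaMode n₀)) x := by
  have h : ∀ c : TrigPoly S.N, c.eval x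
      = Finsupp.linearCombination ℂ (fun k => UnitAddTorus.mFourier k x) c := fun c => rfl
  rw [h, seaCoeff, map_sum]
  refine Finset.sum_congr rfl fun σ _ => ?_
  rw [Finsupp.linearCombination_single]
  rfl

/-- The density of a fermion at a fixed distance from the impurity is uniform in the Fermi sea. -/
theorem integral_seaCoeff_contact (n₀ : ℤ) (n : Fin S.N) (y : ℝ) :
    ∫ x, starRingEnd ℂ ((S.seaCoeff n₀).eval (S.contact n (x, y)))
      * (S.seaCoeff n₀).eval (S.contact n (x, y)) ∂(configMeasure S.N) = 1 := by
  -- The dependence on `y` is absorbed into unimodular factors, which do not affect the norm.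
  let a : Equiv.Perm (Fin S.N) → ℂ := fun σ =>
    slaterCoeff σ * fourier (relabel σ (S.seaMode n₀) (some n)) ((y / S.L : ℝ) : UnitAddCircle)
  let g : C(Config S.N, ℂ) :=
    ∑ σ, a σ • UnitAddTorus.mFourier (contract n (relabel σ (S.seaMode n₀)))
  have hg : ∀ x, (S.seaCoeff n₀).eval (S.contact n (x, y)) = g x := by
    intro x
    rw [eval_seaCoeff, contact, ContinuousMap.sum_apply]
    refine Finset.sum_congr rfl fun σ _ => ?_
    rw [mFourier_update, ContinuousMap.smul_apply, smul_eq_mul, ← mul_assoc]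
  have ha : ∀ σ, ‖a σ‖ = ‖slaterCoeff σ‖ := fun σ => by
    simp only [a, norm_mul, fourier_apply, Circle.norm_coe, mul_one]
  have h1 := ContinuousMap.inner_toLp (𝕜 := ℂ) (configMeasure S.N) g g
  have h2 : ContinuousMap.toLp (E := ℂ) 2 (configMeasure S.N) ℂ g
      = ∑ σ, a σ • planeWave (contract n (relabel σ (S.seaMode n₀))) := by
    rw [map_sum]
    refine Finset.sum_congr rfl fun σ _ => ?_
    rw [map_smul]
    rfl
  rw [h2, inner_sum_planeWave_self (S.contract_relabel_seaMode_injective n₀ n)] at h1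
  simp only [ha, sum_norm_slaterCoeff_sq, Complex.ofReal_one] at h1
  rw [h1]
  simp only [hg, mul_comm]

/-- Integrating over configurations first gives `1` for every `y`, so only the total mass of `U`
survives, whatever its shape. -/
theorem potentialForm_seaCoeff [IsFiniteMeasure S.U] (n₀ : ℤ) :
    S.potentialForm (S.seaCoeff n₀) (S.seaCoeff n₀) = ((S.N * (S.Ubar / S.L) : ℝ) : ℂ) := by
  have h : ∀ n, S.contactForm n (S.seaCoeff n₀) (S.seaCoeff n₀) = (S.Ubar : ℂ) := by
    intro n
    rw [contactForm, integral_prod_symm _ (S.integrable_contact n _ _)]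
    simp only [integral_seaCoeff_contact, integral_const, Ubar]
    simp
  rw [potentialForm_eq]
  simp only [h, Finset.sum_const, Finset.card_univ, Fintype.card_fin, nsmul_eq_mul]
  push_cast
  ring

theorem re_energyForm_seaCoeff [IsFiniteMeasure S.U] (hN : Odd S.N) (hN1 : 1 < S.N)
    (hmh : 0 < S.mh) (n₀ : ℤ) :
    (S.energyForm (S.seaCoeff n₀) (S.seaCoeff n₀)).re
      = (S.δk * n₀) ^ 2 / (2 * S.mi) + S.N * (S.Ubar / S.L) := by
  classical
  -- All modes of the determinant are permutations of one another and share the same free energy, in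
  -- which the host part cancels against `C`.
  have hE : ∀ k, S.seaCoeff n₀ k ≠ 0 → S.freeEnergy k = (S.δk * n₀) ^ 2 / (2 * S.mi) := by
    intro k hk
    rw [seaCoeff, Finsupp.finsetSum_apply] at hk
    obtain ⟨σ, -, hσ⟩ := Finset.exists_ne_zero_of_sum_ne_zero hk
    have hkσ : relabel σ (S.seaMode n₀) = k := by
      by_contra hne
      exact hσ (Finsupp.single_eq_of_ne' hne)
    rw [← hkσ, freeEnergy_relabel, S.freeEnergy_seaMode hN hN1 hmh]
  have hnorm : ‖(S.seaCoeff n₀).toWave‖ ^ 2 = 1 := by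
    rw [norm_toWave_seaCoeff, one_pow]
  rw [re_energyForm_self, potentialForm_seaCoeff, Complex.ofReal_re]
  congr 1
  rw [norm_toWave_sq, Finsupp.sum] at hnorm
  rw [Finsupp.sum, Finset.sum_congr rfl fun k hk => by
    rw [hE k (Finsupp.mem_support_iff.1 hk)], ← Finset.mul_sum, hnorm, mul_one]

theorem norm_initialState (n₀ : ℤ) : ‖S.initialState n₀‖ = 1 := S.norm_toWave_seaCoeff n₀

/-- The form domain exists. -/
theorem exists_isFormEmbedding [IsFiniteMeasure S.U] (hN : Odd S.N) (hN1 : 1 < S.N)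
    (hL : 0 < S.L) (hmi : 0 < S.mi) (hmh : 0 < S.mh) :
    ∃ (Q : Type) (_ : NormedAddCommGroup Q) (_ : InnerProductSpace ℂ Q) (_ : CompleteSpace Q)
      (j : AntisymmPoly S.N →ₗ[ℂ] Q) (G : Q →L[ℂ] fermionSpace S.N), S.IsFormEmbedding j G := by
  obtain ⟨Q, _, _, _, j, hj, hin⟩ := exists_hilbert_completion (S.formCore hN hN1 hL hmi hmh)
  have hin' : ∀ c d, inner ℂ (j c) (j d) = S.energyForm c d
    + ((1 + S.C : ℝ) : ℂ) * inner ℂ (c : TrigPoly S.N).toWave (d : TrigPoly S.N).toWave := hin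
  have hC := S.C_nonneg hN1 hmh
  -- The constant `1` suffices because the energy is nonnegative and the shift is at least `1`.
  obtain ⟨G, hG⟩ := exists_continuous_extension hj (toFermion S.N) ⟨1, fun c => by
    rw [one_mul]
    refine abs_le_of_sq_le_sq' ?_ (norm_nonneg _) |>.2
    have h2 : ‖j c‖ ^ 2 = (S.energyForm c c).re
        + (1 + S.C) * ‖(c : TrigPoly S.N).toWave‖ ^ 2 := by
      rw [@norm_sq_eq_re_inner ℂ, @norm_sq_eq_re_inner ℂ _ _ _ _ (TrigPoly.toWave _), hin']
      simp
    rw [h2, Submodule.coe_norm, coe_toFermion]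
    have h3 := S.re_energyForm_nonneg hN hN1 hL hmi hmh c.isAntisymm
    nlinarith [sq_nonneg ‖(c : TrigPoly S.N).toWave‖]⟩
  exact ⟨Q, inferInstance, inferInstance, inferInstance, j, G, hj, hin', hG⟩

/-! ### Momentum on the form domain and diagonalization of the Hamiltonian. -/

section Dynamics

variable {S} {Q : Type*} [NormedAddCommGroup Q] [InnerProductSpace ℂ Q]
  {j : AntisymmPoly S.N →ₗ[ℂ] Q} {G : Q →L[ℂ] fermionSpace S.N}

/-- On the form domain the impurity momentum is well defined. -/
theorem momentum_eq_re_inner {A : Q →L[ℂ] WaveSpace S.N}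
    (hA : ∀ f k, amplitude (A f) k
      = ((S.δk * k none : ℝ) : ℂ) * amplitude (G f : WaveSpace S.N) k) (f : Q) :
    S.InMomentumDomain (G f) ∧
      S.momentum (G f) = (inner ℂ (G f : WaveSpace S.N) (A f)).re := by
  constructor
  · have := (hasSum_norm_amplitude_sq (A f)).summable
    simp only [hA] at this
    exact this
  · have := Complex.hasSum_re (hasSum_conj_amplitude_mul (G f : WaveSpace S.N) (A f))
    rw [← this.tsum_eq, momentum]
    refine tsum_congr fun k => ?_
    rw [hA, mul_left_comm, Complex.re_ofReal_mul, mul_comm (starRingEnd ℂ _), Complex.mul_conj,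
      Complex.ofReal_re, Complex.normSq_eq_norm_sq]

variable [CompleteSpace Q]

/-- The energy as a function of the eigenvalue of the resolvent. -/
def resolventEnergy (S : System) (μ : ℝ) : ℝ := μ⁻¹ - (1 + S.C)

theorem inner_smul_left_fermion {N : ℕ} (a : ℂ) (x y : fermionSpace N) :
    inner ℂ (a • x) y = starRingEnd ℂ a * inner ℂ x y := inner_smul_left x y a

theorem inner_smul_right_fermion {N : ℕ} (a : ℂ) (x y : fermionSpace N) :
    inner ℂ x (a • y) = a * inner ℂ x y := inner_smul_right x y a

/-- The relation `ψ = G G† (η + (1 + C) ψ)` is read off coefficient by coefficient, the eigenvalues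
being nonzero. The result is exactly the criterion in `hasDerivAt_evolution_iff`, so the domains of
`H` and of the generator coincide. -/
theorem IsFormEmbedding.isHamiltonian_iff_inner (hjG : S.IsFormEmbedding j G) {ι : Type*}
    (b : HilbertBasis ι ℂ (fermionSpace S.N)) (τ : ι → ℝ)
    (hb : ∀ i, (G ∘L G.adjoint) (b i) = (τ i : ℂ) • b i) (ψ η : fermionSpace S.N) :
    S.IsHamiltonian ψ η ↔
      ∀ i, inner ℂ (b i) η = (S.resolventEnergy (τ i) : ℂ) * inner ℂ (b i) ψ := by
  have hτ : ∀ i, (τ i : ℂ) ≠ 0 := by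
    intro i h0
    have h1 := hb i
    rw [h0, zero_smul, ContinuousLinearMap.comp_apply] at h1
    have h2 : inner ℂ (G.adjoint (b i)) (G.adjoint (b i)) = 0 := by
      rw [ContinuousLinearMap.adjoint_inner_right, h1, inner_zero_left]
    exact b.orthonormal.ne_zero i (hjG.eq_zero_of_adjoint_eq_zero (inner_self_eq_zero.1 h2))
  have hT : ∀ x i, inner ℂ (b i) (G (G.adjoint x)) = (τ i : ℂ) * inner ℂ (b i) x := by
    intro x i
    rw [← ContinuousLinearMap.adjoint_inner_left, ← ContinuousLinearMap.adjoint_inner_left,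
      ContinuousLinearMap.adjoint_adjoint, ← ContinuousLinearMap.comp_apply, hb,
      inner_smul_left_fermion,
      Complex.conj_ofReal]
  rw [hjG.isHamiltonian_iff]
  have hi : ∀ i, inner ℂ (b i) η = (S.resolventEnergy (τ i) : ℂ) * inner ℂ (b i) ψ ↔
      inner ℂ (b i) ψ
        = inner ℂ (b i) (G (G.adjoint (η + ((1 + S.C : ℝ) : ℂ) • ψ))) := by
    intro i
    rw [hT, inner_add_right, inner_smul_right_fermion, resolventEnergy]
    push_cast
    have := hτ i
    constructor
    · intro h
      rw [h]
      field_simp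
      ring
    · intro h
      field_simp
      linear_combination -h
  simp only [hi]
  exact ⟨fun h i => by rw [← h], fun h => hilbertBasis_ext b h⟩

end Dynamics

end System

end MobileImpurity

end

/-! ### Energy conservation and the infinite-time momentum. -/

open MobileImpurity in
theorem mainTheorem2 (S : System) (hN : Odd S.N) (hN1 : 1 < S.N) (hL : 0 < S.L)
    (hmi : 0 < S.mi) (hmh : 0 < S.mh) (hU : IsFiniteMeasure S.U)
    (n₀ : ℤ) (p₀ : ℝ) (hp₀ : p₀ = 2 * Real.pi / S.L * n₀)
    (hnd : S.NondegenerateAt p₀) :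
    (∃! W : ℝ → (fermionSpace S.N ≃ₗᵢ[ℂ] fermionSpace S.N), S.IsPropagator W) ∧
    ∀ W : ℝ → (fermionSpace S.N ≃ₗᵢ[ℂ] fermionSpace S.N), S.IsPropagator W →
      (∀ t, S.InMomentumDomain (W t (S.initialState n₀))) ∧
      (∀ t, IntervalIntegrable (fun s => S.momentum (W s (S.initialState n₀))) volume 0 t) ∧
      ∃ pinf : ℝ,
        Tendsto (fun t : ℝ => 1 / t * ∫ s in (0 : ℝ)..t, S.momentum (W s (S.initialState n₀)))
          atTop (𝓝 pinf) ∧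
        |pinf| ≤ Real.sqrt (p₀ ^ 2
          + 2 / Real.pi * S.mi * S.kF * S.Ubar * ((S.N : ℝ) / ((S.N : ℝ) - 1))) := by
  -- The argument does not use that the eigenvalues are nondegenerate: the infinite-time average
  -- exists because the spectrum is discrete, and the bound holds at every time.
  obtain ⟨Q, _, _, _, j, G, hjG⟩ := S.exists_isFormEmbedding hN hN1 hL hmi hmh
  have hGc : IsCompactOperator G := hjG.isCompactOperator hN1 hL hmi hmh
  obtain ⟨A, hA, hAn⟩ := hjG.exists_momentum_operator hN hN1 hL hmi hmh
  have hTs : ((G ∘L G.adjoint : fermionSpace S.N →L[ℂ] fermionSpace S.N) :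
      fermionSpace S.N →ₗ[ℂ] fermionSpace S.N).IsSymmetric := fun x y => by
    change inner ℂ (G (G.adjoint x)) y = inner ℂ x (G (G.adjoint y))
    rw [← ContinuousLinearMap.adjoint_inner_right, ContinuousLinearMap.adjoint_inner_left]
  have hKs : ((G.adjoint ∘L G : Q →L[ℂ] Q) : Q →ₗ[ℂ] Q).IsSymmetric := fun x y => by
    change inner ℂ (G.adjoint (G x)) y = inner ℂ x (G.adjoint (G y))
    rw [ContinuousLinearMap.adjoint_inner_left, ContinuousLinearMap.adjoint_inner_right]
  obtain ⟨ι, b, τ, hb⟩ := exists_hilbertBasis_eigenvectors (G ∘L G.adjoint)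
    (hGc.comp_clm G.adjoint) hTs
  obtain ⟨ι', b', κ, hb'⟩ := exists_hilbertBasis_eigenvectors (G.adjoint ∘L G)
    (hGc.clm_comp G.adjoint) hKs
  let V : ℝ → (fermionSpace S.N ≃ₗᵢ[ℂ] fermionSpace S.N) :=
    evolution b fun i => S.resolventEnergy (τ i)
  let V' : ℝ → (Q ≃ₗᵢ[ℂ] Q) := evolution b' fun i => S.resolventEnergy (κ i)
  have hV : S.IsPropagator V :=
    { zero := evolution_zero b _
      add := evolution_add b _
      continuous := continuous_evolution b _
      generator := fun ψ η =>
        (hjG.isHamiltonian_iff_inner b τ hb ψ η).trans (hasDerivAt_evolution_iff b _ ψ η).symm }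
  have huniq : ∀ W, S.IsPropagator W → W = V := by
    intro W hW
    refine eq_evolution b _ W hW.zero hW.add fun i => ?_
    refine (hW.generator _ _).1 ((hjG.isHamiltonian_iff_inner b τ hb _ _).2 fun i' => ?_)
    classical
    rw [System.inner_smul_right_fermion, orthonormal_iff_ite.1 b.orthonormal]
    split_ifs with h
    · rw [h]
    · simp
  refine ⟨⟨V, hV, huniq⟩, fun W hW => ?_⟩
  rw [huniq W hW]
  clear hW W
  have hVG : ∀ t f, V t (G f) = G (V' t f) := by
    intro t f
    refine hilbertBasis_induction b' (P := fun f => V t (G f) = G (V' t f)) (fun i => ?_)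
      (by simp) (fun x y hx hy => by simp [hx, hy]) (fun a x hx => by simp [hx])
      (fun x hx => ?_) f
    -- `G` intertwines `G† G` with `G G†`. If `κ i = 0`, then `G (b' i) = 0`, so the convention `0⁻¹
    -- = 0` in `resolventEnergy` has no effect.
    · have h1 : (G ∘L G.adjoint) (G (b' i)) = (κ i : ℂ) • G (b' i) := by
        rw [← map_smul, ← hb' i]
        rfl
      have h2 := evolution_eigenvector b (G ∘L G.adjoint) hTs τ hb S.resolventEnergy h1 t
      have h3 := evolution_basis b' (fun i => S.resolventEnergy (κ i)) t i
      change evolution b _ t (G (b' i)) = G (evolution b' _ t (b' i))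
      rw [h2, h3, map_smul]
    · have hcl : IsClosed {x | V t (G x) = G (V' t x)} :=
        isClosed_eq ((V t).continuous.comp G.continuous) (G.continuous.comp (V' t).continuous)
      refine hcl.closure_subset (Metric.mem_closure_iff.2 fun ε hε => ?_)
      obtain ⟨y, hy, hxy⟩ := hx ε hε
      exact ⟨y, hy, by rwa [dist_eq_norm]⟩
  obtain ⟨c, hc⟩ := (S.seaCoeff_isAntisymm n₀).exists_eq
  have hinit : S.initialState n₀ = G (j c) := by
    rw [hjG.map_apply]
    apply Subtype.ext
    rw [coe_toFermion, hc]
    rfl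
  have hstate : ∀ t, V t (S.initialState n₀) = G (V' t (j c)) := fun t => by rw [hinit, hVG]
  -- This bounded operator represents the form `⟨G f, A f⟩`, the momentum expectation, on `Q`.
  let X : Q →L[ℂ] Q := G.adjoint ∘L ((fermionSpace S.N).subtypeL.adjoint ∘L A)
  have hmom : ∀ t, S.momentum (V t (S.initialState n₀))
      = (inner ℂ (V' t (j c)) (X (V' t (j c)))).re := by
    intro t
    rw [hstate, (System.momentum_eq_re_inner hA _).2]
    congr 1
    change _ = inner ℂ _ (G.adjoint ((fermionSpace S.N).subtypeL.adjoint (A _)))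
    rw [ContinuousLinearMap.adjoint_inner_right, ContinuousLinearMap.adjoint_inner_right]
    rfl
  have hcont : Continuous fun t => inner ℂ (V' t (j c)) (X (V' t (j c))) :=
    continuous_inner_evolution b' _ X _ _
  have hcontre : Continuous fun t => S.momentum (V t (S.initialState n₀)) := by
    simp only [hmom]
    exact Complex.continuous_re.comp hcont
  set B : ℝ := p₀ ^ 2 + 2 / Real.pi * S.mi * S.kF * S.Ubar * ((S.N : ℝ) / ((S.N : ℝ) - 1)) with hB
  have hbound : ∀ t, |S.momentum (V t (S.initialState n₀))| ≤ Real.sqrt B := by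
    intro t
    have hnorm : ‖G (V' t (j c))‖ = 1 := by
      rw [← hstate, LinearIsometryEquiv.norm_map, S.norm_initialState]
    -- Conservation of energy: `V'` preserves the shifted form norm and `V` the `L²` norm, so their
    -- difference keeps its initial value.
    have h1 := hAn (V' t (j c))
    rw [hnorm, LinearIsometryEquiv.norm_map, hjG.norm_sq, hc,
      S.re_energyForm_seaCoeff hN hN1 hmh n₀] at h1
    have h2 : ‖(S.seaCoeff n₀).toWave‖ = 1 := S.norm_initialState n₀
    rw [h2] at h1
    have h3 : ‖A (V' t (j c))‖ ^ 2 ≤ B := by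
      refine h1.trans_eq ?_
      have hN' : (S.N : ℝ) - 1 ≠ 0 := by
        have : (1 : ℝ) < S.N := by exact_mod_cast hN1
        linarith
      have hpi := Real.pi_ne_zero
      -- Since `kF = π (N - 1) / L`, the term `2 m_i N Ū / L` is the one in the stated bound.
      rw [hB, hp₀, System.kF, System.δk]
      field_simp
      ring
    rw [hstate, (System.momentum_eq_re_inner hA _).2]
    refine (Complex.abs_re_le_norm _).trans ((norm_inner_le_norm _ _).trans ?_)
    rw [← Submodule.coe_norm, hnorm, one_mul]
    exact Real.le_sqrt_of_sq_le h3
  refine ⟨fun t => ?_, fun t => hcontre.intervalIntegrable _ _, ?_⟩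
  · rw [hstate]
    exact (System.momentum_eq_re_inner hA _).1
  obtain ⟨m, hm⟩ := hasTimeMean_inner_evolution b' (fun i => S.resolventEnergy (κ i)) X (j c) (j c)
  have hlim : Tendsto (fun t : ℝ => 1 / t * ∫ s in (0 : ℝ)..t,
      S.momentum (V s (S.initialState n₀))) atTop (𝓝 m.re) := by
    refine ((Complex.continuous_re.tendsto m).comp hm).congr fun t => ?_
    rw [Function.comp_apply, Complex.re_ofReal_mul]
    congr 1
    have h := Complex.reCLM.intervalIntegral_comp_comm (hcont.intervalIntegrable (μ := volume) 0 t)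
    simp only [hmom]
    exact h.symm
  refine ⟨m.re, hlim, le_of_tendsto hlim.abs ?_⟩
  filter_upwards [eventually_gt_atTop 0] with t ht
  rw [abs_mul, abs_of_pos (by positivity : 0 < 1 / t)]
  have h := intervalIntegral.norm_integral_le_of_norm_le_const (a := 0) (b := t)
    (f := fun s => S.momentum (V s (S.initialState n₀))) (C := Real.sqrt B) fun s _ => hbound s
  rw [sub_zero, abs_of_pos ht, Real.norm_eq_abs] at h
  calc 1 / t * |∫ s in (0 : ℝ)..t, S.momentum (V s (S.initialState n₀))|
      ≤ 1 / t * (Real.sqrt B * t) := by gcongr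
    _ = Real.sqrt B := by field_simp
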